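/- Let $\xi_{std}=\ker(dz-y\,dx)$ be the standard contact structure on $\mathbb R^3$. A Legendrian embedding of a graph is an embedding in $\mathbb R^3$ whose edges are smooth immersed arcs tangent to $\xi_{std}$, such that no two edges leave a common vertex in the same direction. Its front projection is the image under $(x,y,z)\mapsto(x,z)$. The front is called generic if the vertices have distinct images that do not lie on the images of open edges, the edges have $x'\neq0$ at their end points, the singular points of the edges are semicubical cusps ($x'=0$, $x''\neq0$), and there are only finitely many crossings, none of them at a cusp. (Fronts are assumed generic, as usual; crossings are then transverse.) For a cycle $\gamma$ of the graph, $tb(\gamma)$ is the twisting of the contact planes along $\gamma$ relative to the Seifert framing, that is, the linking number of $\gamma$ with its push-off by a small $\varepsilon>0$ in the direction $\partial_z$ transverse to $\xi_{std}$, where the linking number is half the signed number of crossings between the two curves in the front projection. Let $TB_r$ be the sum of $tb(\gamma)$ over all cycles $\gamma$ of length $r$, and $TB$ the sum over all cycles (cycles are taken without orientation and base point). Put - $w_e$: the sum over all edges of the signed number of self-crossings of the edge; - $w_{ae}$: the sum over all unordered pairs of adjacent edges of the signed number of crossings between the two edges, one edge oriented into the common vertex and the other out of it; - $c_e$: the total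 number of cusps in the interiors of edges; - $c_v$: the sum over all vertices $v$ of the number of unordered pairs of edges at $v$ that form a cusp at $v$, that is, leave $v$ to the same side in the front. **Theorem.** Let $K_n$ be a Legendrian embedding of the complete graph on $n$ vertices in $(\mathbb R^3,\xi_{std})$ with generic front projection. Then, for every cycle, the linking numbers defining $tb$ are constant for all sufficiently small $\varepsilon>0$ and the value does not depend on how the cycle is traversed. For $3\le r\le n$, $$TB_r(K_n)=\frac{(n-3)!}{(n-r)!}\,TB_3(K_n),$$ hence $$TB(K_n)=TB_3(K_n)\cdot\sum_{r=3}^{n}\frac{(n-3)!}{(n-r)!}.$$ Moreover $$TB_3(K_n)=(n-2)\,w_e+w_{ae}-\tfrac12\bigl[(n-2)\,c_e+c_v\bigr].$$ -/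

import Mathlib

open scoped ContDiff Topology

namespace LegendrianGraph

/-- Euclidean three-space; the coordinates `p 0`, `p 1`, `p 2` of a point are `x`, `y`, `z`. -/
abbrev Space : Type := EuclideanSpace ℝ (Fin 3)

/-- The standard contact plane `ξ_std = ker (dz - y dx)` at the point `p`. -/
def stdContactPlane (p : Space) : Submodule ℝ Space where
  carrier := {v | v 2 - p 1 * v 0 = 0}
  add_mem' := by
    intro a b ha hb
    simp only [Set.mem_ofPred_eq, PiLp.add_apply] at *
    linear_combination ha + hb
  zero_mem' := by simp
  smul_mem' := by
    intro c a ha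
    simp only [Set.mem_ofPred_eq, PiLp.smul_apply, smul_eq_mul] at *
    linear_combination c * ha

/-- The front projection `(x, y, z) ↦ (x, z)`. -/
def front (p : Space) : ℝ × ℝ := (p 0, p 2)

/-- A Legendrian embedding of a graph in `(ℝ³, ξ_std)`.  Every edge is parametrized by `[0, 1]`
in both directions (one for each dart); it is a smooth immersed arc, tangent to the contact
planes.  Distinct edges meet only in common end points, and two edges at a common
vertex do not leave that vertex in the same direction. -/
structure LegendrianEmbedding {V : Type*} (G : SimpleGraph V) where
  vertex : V → Space
  edge : G.Dart → ℝ → Space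
  contDiff : ∀ d, ContDiff ℝ ∞ (edge d)
  edge_symm : ∀ d t, edge d.symm t = edge d (1 - t)
  edge_zero : ∀ d, edge d 0 = vertex d.fst
  edge_one : ∀ d, edge d 1 = vertex d.snd
  immersed : ∀ d, ∀ t ∈ Set.Icc (0 : ℝ) 1, deriv (edge d) t ≠ 0
  legendrian : ∀ d, ∀ t ∈ Set.Icc (0 : ℝ) 1, deriv (edge d) t ∈ stdContactPlane (edge d t)
  vertex_injective : Function.Injective vertex
  edge_ne_vertex : ∀ d, ∀ t ∈ Set.Ioo (0 : ℝ) 1, ∀ v, edge d t ≠ vertex v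
  edge_injective : ∀ d d', ∀ s ∈ Set.Ioo (0 : ℝ) 1, ∀ t ∈ Set.Ioo (0 : ℝ) 1,
    edge d s = edge d' t → (d' = d ∧ t = s) ∨ (d' = d.symm ∧ t = 1 - s)
  not_tangent : ∀ d d', d.fst = d'.fst → d ≠ d' →
    ¬ SameRay ℝ (deriv (edge d) 0) (deriv (edge d') 0)

/-! Oriented curves are recorded as sets of pairs (point on the curve, velocity vector there). -/

/-- The crossings in the front projection at which `A` passes over `B`.  Seen with the `x`-axis to
the right and the `z`-axis upwards, the positive `y`-axis of the right-handed frame `(x, y, z)`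
points away from the viewer, so the strand with the smaller `y` is the upper one. -/
def crossings (A B : Set (Space × Space)) : Set ((Space × Space) × (Space × Space)) :=
  {c | c.1 ∈ A ∧ c.2 ∈ B ∧ front c.1.1 = front c.2.1 ∧ c.1.1 1 < c.2.1 1}

/-- The sign of a crossing (upper strand first): `+1` if the upper velocity is turned
counterclockwise onto the lower one in the `(x, z)`-plane, `-1` if clockwise. -/
noncomputable def crossingSign (c : (Space × Space) × (Space × Space)) : ℤ :=
  (SignType.sign (c.1.2 0 * c.2.2 2 - c.1.2 2 * c.2.2 0) : ℤ)

/-- The signed number of the crossings of `A` over `B`. -/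
noncomputable def overCrossings (A B : Set (Space × Space)) : ℤ :=
  ∑ᶠ c ∈ crossings A B, crossingSign c

/-- The writhe of an oriented curve: the signed number of its crossings with itself. -/
noncomputable def writhe (A : Set (Space × Space)) : ℤ := overCrossings A A

/-- The signed number of all crossings between two oriented curves. -/
noncomputable def mutualWrithe (A B : Set (Space × Space)) : ℤ :=
  overCrossings A B + overCrossings B A

/-- The linking number of two disjoint oriented closed curves: half the signed number of the
crossings between them. -/
noncomputable def linkingNumber (A B : Set (Space × Space)) : ℝ := (mutualWrithe A B : ℝ) / 2

/-- The push-off of a curve by `ε` in the direction `∂/∂z`, which is everywhere transverse to the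
contact planes. -/
noncomputable def pushOff (ε : ℝ) (A : Set (Space × Space)) : Set (Space × Space) :=
  (fun a => (a.1 + EuclideanSpace.single 2 ε, a.2)) '' A

/-- The Thurston-Bennequin number of a Legendrian closed curve: its linking number with its
small push-off transverse to the contact planes, i.e. the contact framing compared with the
Seifert framing. -/
noncomputable def thurstonBennequin (A : Set (Space × Space)) : ℝ :=
  Filter.limUnder (𝓝[>] (0 : ℝ)) fun ε => linkingNumber A (pushOff ε A)

/-- `S` is the edge set of a cycle of `G`. -/
def IsCycleEdgeSet {V : Type*} (G : SimpleGraph V) (S : Finset (Sym2 V)) : Prop :=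
  ∃ p : (Σ v : V, G.Walk v v), p.2.IsCycle ∧ ∀ e, e ∈ S ↔ e ∈ p.2.edges

open Classical in
/-- The cycles of a finite graph, as unoriented cycles without base point. -/
noncomputable def cycles {V : Type*} [Fintype V] (G : SimpleGraph V) :
    Finset (Finset (Sym2 V)) :=
  Finset.univ.filter (IsCycleEdgeSet G)

/-- The cycles of length `r`. -/
noncomputable def cyclesOfLength {V : Type*} [Fintype V] (G : SimpleGraph V) (r : ℕ) :
    Finset (Finset (Sym2 V)) :=
  (cycles G).filter fun S => S.card = r

namespace LegendrianEmbedding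

variable {V : Type*} {G : SimpleGraph V}

/-- The interior of an edge, oriented by the dart `d`. -/
def openEdge (F : LegendrianEmbedding G) (d : G.Dart) : Set (Space × Space) :=
  (fun t => (F.edge d t, deriv (F.edge d) t)) '' Set.Ioo 0 1

/-- The oriented closed curve traversed by a closed walk. -/
def loop (F : LegendrianEmbedding G) {v : V} (c : G.Walk v v) : Set (Space × Space) :=
  ⋃ d ∈ c.darts, (fun t => (F.edge d t, deriv (F.edge d) t)) '' Set.Ico 0 1

open Classical in
/-- The Thurston-Bennequin number of a cycle, computed with either orientation. -/
noncomputable def tb (F : LegendrianEmbedding G) (S : Finset (Sym2 V)) : ℝ :=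
  if h : IsCycleEdgeSet G S then thurstonBennequin (F.loop h.choose.2) else 0

/-- The front projection is generic: the vertices have different images, which are not on the
images of the open edges, and the front is not singular there; the singular points in the
interior of an edge are semicubical cusps; there are finitely many crossings, at smooth points of
both strands.  (There the two strands have different slopes `y = dz/dx`, so
that crossings are transverse.) -/
structure HasGenericFront (F : LegendrianEmbedding G) : Prop where
  front_vertex_injective : Function.Injective fun v => front (F.vertex v)
  front_edge_ne_vertex : ∀ d, ∀ t ∈ Set.Ioo (0 : ℝ) 1, ∀ v, front (F.edge d t) ≠ front (F.vertex v)
  smooth_at_vertex : ∀ d, (deriv (F.edge d) 0) 0 ≠ 0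
  semicubical : ∀ d, ∀ t ∈ Set.Ioo (0 : ℝ) 1, (deriv (F.edge d) t) 0 = 0 →
    (deriv (deriv (F.edge d)) t) 0 ≠ 0
  smooth_at_crossing : ∀ d d', ∀ s ∈ Set.Ioo (0 : ℝ) 1, ∀ t ∈ Set.Ioo (0 : ℝ) 1,
    front (F.edge d s) = front (F.edge d' t) → F.edge d s ≠ F.edge d' t →
      (deriv (F.edge d) s) 0 ≠ 0 ∧ (deriv (F.edge d') t) 0 ≠ 0
  finite_crossings : ∀ d d', (crossings (F.openEdge d) (F.openEdge d')).Finite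

/-- The number of cusps in the interior of an edge. -/
noncomputable def cuspsAlongEdge (F : LegendrianEmbedding G) (d : G.Dart) : ℕ :=
  {t ∈ Set.Ioo (0 : ℝ) 1 | (deriv (F.edge d) t) 0 = 0}.ncard

section Counts

variable [Fintype V] [LinearOrder V] [DecidableRel G.Adj]

/-- `TB_r`, the sum of the Thurston-Bennequin numbers of the cycles of length `r`. -/
noncomputable def TBr (F : LegendrianEmbedding G) (r : ℕ) : ℝ :=
  ∑ S ∈ cyclesOfLength G r, F.tb S

/-- The total Thurston-Bennequin number. -/
noncomputable def TB (F : LegendrianEmbedding G) : ℝ := ∑ S ∈ cycles G, F.tb S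

/-! In the following counts the order of the vertices serves only to list every edge, and every
unordered pair of edges at a vertex, exactly once. -/

/-- The edge writhe `w_e`. -/
noncomputable def edgeWrithe (F : LegendrianEmbedding G) : ℤ :=
  ∑ d : G.Dart with d.fst < d.snd, writhe (F.openEdge d)

/-- The adjacent edge writhe `w_ae`: the edges of every pair of adjacent edges are oriented so
that one leads into and the other out of the common vertex. -/
noncomputable def adjacentEdgeWrithe (F : LegendrianEmbedding G) : ℤ :=
  ∑ p : G.Dart × G.Dart with p.1.snd = p.2.fst ∧ p.1.fst < p.2.snd,
    mutualWrithe (F.openEdge p.1) (F.openEdge p.2)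

/-- The edge cusps `c_e`. -/
noncomputable def edgeCusps (F : LegendrianEmbedding G) : ℕ :=
  ∑ d : G.Dart with d.fst < d.snd, F.cuspsAlongEdge d

open Classical in
/-- The number `c(v)` of pairs of edges at `v` which leave `v` on the same side in the front. -/
noncomputable def cuspsAtVertex (F : LegendrianEmbedding G) (v : V) : ℕ :=
  (Finset.univ.filter fun p : G.Dart × G.Dart =>
    p.1.fst = v ∧ p.2.fst = v ∧ p.1.snd < p.2.snd ∧
      0 < (deriv (F.edge p.1) 0) 0 * (deriv (F.edge p.2) 0) 0).card

/-- The vertex cusps `c_v`. -/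
noncomputable def vertexCusps (F : LegendrianEmbedding G) : ℕ := ∑ v, F.cuspsAtVertex v

end Counts

end LegendrianEmbedding

end LegendrianGraph

/-! The proof has an analytic and a combinatorial half.

Locally: along Legendrian curves `dz = y dx`, so a front crossing has the sign of `x₁' x₂'`,
whichever strand is on top. The crossings of a cycle with its push-off are the pairs of points with
equal `x`, heights `z` differing by `ε`, and different `y`. As `ε → 0+` they can accumulate only at
pairs of points with the same front. A crossing of the cycle persists with its sign (inverse
function theorem). A regular point paired with itself contributes nothing. At a cusp, interior to an
edge or formed at a vertex, the height difference of the two branches is strictly monotone in `x`,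
so exactly one pair appears; the branches are traversed in opposite `x`-directions and the pair
counts `-1`. Compactness adds these local counts up to `2 tb = 2 · writhe - number of cusps` for all
small `ε` (`eventually_finsum_eq_sum_localIndex`, `HasGenericFront.eventually_linkingNumber`, with
`twiceTB` as right-hand side). The expression is invariant under reversal, so `tb` depends on the
cycle only.

Globally: cycles of length `r` are injective cyclic sequences `ZMod r ↪ V` up to the dihedral group
of order `2r`. In the sum of `twiceTB` over all sequences, the positions `i` and `j` of two edges
are fixed first. If the edges are disjoint, exchanging the two vertices of one edge reverses it and
flips the sign of its crossings with the other, so the sum vanishes. The remaining terms involve one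
edge or a path of two edges, which extend to `(n-2)!/(n-r)!` and `(n-3)!/(n-r)!` sequences
respectively. The quotient of these numbers is `n - 2`, independent of `r`; hence all `TB_r` are
multiples of one expression, which is `TB_3` (`sum_comp_embedding`,
`HasGenericFront.sum_mutualWrithe_eq_zero`, `HasGenericFront.sum_twiceTB`). -/

namespace LegendrianGraph

open Set Filter

/-! ### Localization of a count of solutions -/

section Localization

variable {X : Type*} [TopologicalSpace X]

/-- For small positive `ε`, the weighted number of solutions near `p` is `k`. -/
def HasLocalIndex (Sol : ℝ → Set X) (w : X → ℤ) (p : X) (k : ℤ) : Prop :=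
  ∃ U ∈ 𝓝 p, ∀ V ∈ 𝓝 p, V ⊆ U →
    ∀ᶠ ε in 𝓝[>] (0 : ℝ), (Sol ε ∩ V).Finite ∧ ∑ᶠ q ∈ Sol ε ∩ V, w q = k

theorem HasLocalIndex.of_empty {Sol : ℝ → Set X} {w : X → ℤ} {p : X} {U : Set X}
    (hU : U ∈ 𝓝 p) (h : ∀ᶠ ε in 𝓝[>] (0 : ℝ), Sol ε ∩ U = ∅) : HasLocalIndex Sol w p 0 := by
  refine ⟨U, hU, fun V _ hVU => ?_⟩
  filter_upwards [h] with ε hε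
  have : Sol ε ∩ V = ∅ := by
    rw [eq_empty_iff_forall_notMem] at hε ⊢
    exact fun q hq => hε q ⟨hq.1, hVU hq.2⟩
  simp [this]

theorem HasLocalIndex.of_singleton {Sol : ℝ → Set X} {w : X → ℤ} {p : X} {k : ℤ} {U : Set X}
    (hU : U ∈ 𝓝 p) {q : ℝ → X} (hq : Tendsto q (𝓝[>] 0) (𝓝 p))
    (h : ∀ᶠ ε in 𝓝[>] (0 : ℝ), Sol ε ∩ U = {q ε} ∧ w (q ε) = k) :
    HasLocalIndex Sol w p k := by
  refine ⟨U, hU, fun V hV hVU => ?_⟩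
  filter_upwards [h, hq hV] with ε hε hqV
  have : Sol ε ∩ V = {q ε} := by
    rw [Set.ext_iff] at hε ⊢
    intro x
    constructor
    · exact fun hx => (hε.1 x).1 ⟨hx.1, hVU hx.2⟩
    · rintro rfl
      exact ⟨((hε.1 (q ε)).2 rfl).1, hqV⟩
  simp [this, hε.2]

/-- The points of `S` get disjoint neighbourhoods on which the local counts still hold; this is why
`HasLocalIndex` quantifies over all smaller neighbourhoods. The rest of `K` is compact, hence
covered by finitely many sets that are free of solutions for small `ε`. -/
theorem eventually_finsum_eq_sum_localIndex [T2Space X] {Sol : ℝ → Set X} {w k : X → ℤ}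
    {K : Set X} (hK : IsCompact K) (hSol : ∀ ε, Sol ε ⊆ K) (S : Finset X)
    (hS : ∀ p ∈ S, HasLocalIndex Sol w p (k p))
    (h0 : ∀ p ∈ K, p ∉ S → ∃ U ∈ 𝓝 p, ∀ᶠ ε in 𝓝[>] (0 : ℝ), Sol ε ∩ U = ∅) :
    ∀ᶠ ε in 𝓝[>] (0 : ℝ), (Sol ε).Finite ∧ ∑ᶠ q ∈ Sol ε, w q = ∑ p ∈ S, k p := by
  choose! U hU hUV using hS
  obtain ⟨D, hD, hDd⟩ := S.finite_toSet.t2_separation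
  set V : X → Set X := fun p => D p ∩ interior (U p) with hV
  have hVo : ∀ p, IsOpen (V p) := fun p => (hD p).2.inter isOpen_interior
  have hVm : ∀ p ∈ S, V p ∈ 𝓝 p := fun p hp =>
    (hVo p).mem_nhds ⟨(hD p).1, mem_interior_iff_mem_nhds.2 (hU p hp)⟩
  have hVd : (S : Set X).PairwiseDisjoint V := fun p hp q hq hpq =>
    (hDd hp hq hpq).mono inter_subset_left inter_subset_left
  have hloc : ∀ᶠ ε in 𝓝[>] (0 : ℝ), ∀ p ∈ S,
      (Sol ε ∩ V p).Finite ∧ ∑ᶠ q ∈ Sol ε ∩ V p, w q = k p := by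
    rw [Filter.eventually_all_finset]
    exact fun p hp => hUV p hp _ (hVm p hp) (inter_subset_right.trans interior_subset)
  have hC : IsCompact (K \ ⋃ p ∈ S, V p) :=
    hK.diff (isOpen_biUnion fun p _ => hVo p)
  have hfar : ∀ᶠ ε in 𝓝[>] (0 : ℝ), Sol ε ∩ (K \ ⋃ p ∈ S, V p) = ∅ := by
    refine hC.induction_on (p := fun A => ∀ᶠ ε in 𝓝[>] (0 : ℝ), Sol ε ∩ A = ∅) (by simp) ?_ ?_ ?_
    · intro A B hAB hB
      filter_upwards [hB] with ε hε
      exact subset_empty_iff.1 (hε ▸ inter_subset_inter_right _ hAB)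
    · intro A B hA hB
      filter_upwards [hA, hB] with ε h1 h2
      rw [inter_union_distrib_left, h1, h2, union_empty]
    · intro p hp
      have hpS : p ∉ S := fun h => hp.2 (mem_biUnion h (mem_of_mem_nhds (hVm p h)))
      obtain ⟨W, hW, hW'⟩ := h0 p hp.1 hpS
      exact ⟨W, mem_nhdsWithin_of_mem_nhds hW, hW'⟩
  filter_upwards [hloc, hfar] with ε h1 h2
  have hun : Sol ε = ⋃ p ∈ (S : Set X), Sol ε ∩ V p := by
    ext q
    simp only [mem_iUnion, mem_inter_iff, exists_prop, Finset.mem_coe]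
    constructor
    · intro hq
      by_contra hcon
      have : q ∈ Sol ε ∩ (K \ ⋃ p ∈ S, V p) := by
        refine ⟨hq, hSol ε hq, ?_⟩
        simp only [mem_iUnion, exists_prop, not_exists, not_and]
        exact fun p hp hqp => hcon ⟨p, hp, hq, hqp⟩
      rw [h2] at this
      exact this
    · rintro ⟨p, -, hq, -⟩
      exact hq
  have hfin : ∀ p ∈ (S : Set X), (Sol ε ∩ V p).Finite := fun p hp => (h1 p hp).1
  constructor
  · rw [hun]
    exact S.finite_toSet.biUnion hfin
  · conv_lhs => rw [hun]
    rw [finsum_mem_biUnion (hVd.mono fun p => inter_subset_right) S.finite_toSet hfin,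
      finsum_mem_coe_finset]
    exact Finset.sum_congr rfl fun p hp => (h1 p hp).2

end Localization

/-! ### Pairs of points of two arcs with equal `x` and `z`-difference `ε` -/

/-- The derivative may vanish at `0`, so that branches of cusps are covered; the inverse is then
continuous up to the end point but differentiable only in the interior. -/
theorem exists_inverse_of_deriv_pos {x : ℝ → ℝ} {δ : ℝ} (hδ : 0 < δ) (hx : Differentiable ℝ x)
    (hpos : ∀ t ∈ Ioc 0 δ, 0 < deriv x t) :
    x 0 < x δ ∧ ∃ g : ℝ → ℝ, (∀ t ∈ Icc 0 δ, g (x t) = t) ∧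
      ContinuousOn g (Icc (x 0) (x δ)) ∧
      (∀ ξ ∈ Icc (x 0) (x δ), g ξ ∈ Icc 0 δ ∧ x (g ξ) = ξ) ∧
      (∀ ξ ∈ Ioo (x 0) (x δ), g ξ ∈ Ioo 0 δ) ∧
      ∀ ξ ∈ Ioo (x 0) (x δ), HasDerivAt g (deriv x (g ξ))⁻¹ ξ := by
  have hmono : StrictMonoOn x (Icc 0 δ) := by
    refine strictMonoOn_of_deriv_pos (convex_Icc 0 δ) hx.continuous.continuousOn ?_
    intro t ht
    rw [interior_Icc] at ht
    exact hpos t ⟨ht.1, ht.2.le⟩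
  have h0 : (0 : ℝ) ∈ Icc 0 δ := ⟨le_rfl, hδ.le⟩
  have h1 : δ ∈ Icc 0 δ := ⟨hδ.le, le_rfl⟩
  have hlt : x 0 < x δ := hmono h0 h1 hδ
  have hsurj : ∀ ξ ∈ Icc (x 0) (x δ), ∃ t ∈ Icc 0 δ, x t = ξ := fun ξ hξ =>
    intermediate_value_Icc hδ.le hx.continuous.continuousOn hξ
  set g : ℝ → ℝ := Function.invFunOn x (Icc 0 δ)
  have hg : ∀ ξ ∈ Icc (x 0) (x δ), g ξ ∈ Icc 0 δ ∧ x (g ξ) = ξ := fun ξ hξ =>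
    ⟨Function.invFunOn_mem (hsurj ξ hξ), Function.invFunOn_eq (hsurj ξ hξ)⟩
  have hgx : ∀ t ∈ Icc 0 δ, g (x t) = t := fun t ht =>
    hmono.injOn.leftInvOn_invFunOn ht
  have hcont : ContinuousOn g (Icc (x 0) (x δ)) := by
    rw [continuousOn_iff_isClosed]
    intro C hC
    refine ⟨x '' (C ∩ Icc 0 δ),
      ((isCompact_Icc.inter_left hC).image hx.continuous).isClosed, ?_⟩
    ext ξ
    constructor
    · rintro ⟨h, hξ⟩
      exact ⟨⟨g ξ, ⟨h, (hg ξ hξ).1⟩, (hg ξ hξ).2⟩, hξ⟩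
    · rintro ⟨⟨t, ⟨htC, ht⟩, rfl⟩, hξ⟩
      refine ⟨?_, hξ⟩
      rw [mem_preimage, hgx t ht]
      exact htC
  have hgIoo : ∀ ξ ∈ Ioo (x 0) (x δ), g ξ ∈ Ioo 0 δ := by
    intro ξ hξ
    obtain ⟨h2, h3⟩ := hg ξ ⟨hξ.1.le, hξ.2.le⟩
    refine ⟨lt_of_le_of_ne h2.1 ?_, lt_of_le_of_ne h2.2 ?_⟩
    · intro h
      rw [← h] at h3
      exact hξ.1.ne h3
    · intro h
      rw [h] at h3
      exact hξ.2.ne h3.symm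
  refine ⟨hlt, g, hgx, hcont, hg, hgIoo, fun ξ hξ => ?_⟩
  refine HasDerivAt.of_local_left_inverse (hcont.continuousAt (Icc_mem_nhds hξ.1 hξ.2))
    (hx (g ξ)).hasDerivAt ?_ ?_
  · have := hgIoo ξ hξ
    exact (hpos _ ⟨this.1, this.2.le⟩).ne'
  · filter_upwards [Icc_mem_nhds hξ.1 hξ.2] with η hη
    exact (hg η hη).2

theorem exists_forall_Ioc_of_eventually {P : ℝ → Prop} (h : ∀ᶠ t in 𝓝[>] (0 : ℝ), P t) :
    ∃ δ > 0, ∀ t ∈ Ioc (0 : ℝ) δ, P t := by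
  obtain ⟨δ, hδ, h'⟩ := mem_nhdsGT_iff_exists_Ioc_subset.1 h
  exact ⟨δ, hδ, fun t ht => h' ht⟩

/-- Two arcs issuing to the right from a common point of the front, the first above the second. -/
theorem exists_unique_pair_of_wedge {x₁ y₁ z₁ x₂ y₂ z₂ : ℝ → ℝ}
    (hx₁ : Differentiable ℝ x₁) (hx₂ : Differentiable ℝ x₂)
    (hz₁ : Differentiable ℝ z₁) (hz₂ : Differentiable ℝ z₂)
    (hx : x₁ 0 = x₂ 0) (hz : z₁ 0 = z₂ 0)
    (h₁ : ∀ᶠ t in 𝓝[>] (0 : ℝ), 0 < deriv x₁ t ∧ deriv z₁ t = y₁ t * deriv x₁ t)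
    (h₂ : ∀ᶠ t in 𝓝[>] (0 : ℝ), 0 < deriv x₂ t ∧ deriv z₂ t = y₂ t * deriv x₂ t)
    (hlt : ∃ η > 0, ∀ u ∈ Ioc (0 : ℝ) η, ∀ v ∈ Ioc (0 : ℝ) η, x₁ u = x₂ v → y₂ v < y₁ u)
    {δ₀ : ℝ} (hδ₀ : 0 < δ₀) :
    ∃ q : ℝ → ℝ × ℝ, Tendsto q (𝓝[>] 0) (𝓝 (0, 0)) ∧
      ∃ δ > 0, δ ≤ δ₀ ∧ (∀ᶠ ε in 𝓝[>] (0 : ℝ), (q ε).1 ∈ Ioo 0 δ ∧ (q ε).2 ∈ Ioo 0 δ ∧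
        y₂ (q ε).2 < y₁ (q ε).1 ∧ 0 < deriv x₁ (q ε).1 ∧ 0 < deriv x₂ (q ε).2 ∧
        ∀ u ∈ Ico 0 δ, ∀ v ∈ Ico 0 δ, (x₁ u = x₂ v ∧ z₁ u = z₂ v + ε ↔ (u, v) = q ε)) ∧
        (∀ u ∈ Ico 0 δ, ∀ v ∈ Ico 0 δ, x₁ u = x₂ v → z₂ v ≤ z₁ u) ∧
        InjOn x₁ (Ico 0 δ) ∧ InjOn x₂ (Ico 0 δ) := by
  obtain ⟨δ₁, hδ₁, h₁⟩ := exists_forall_Ioc_of_eventually h₁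
  obtain ⟨δ₂, hδ₂, h₂⟩ := exists_forall_Ioc_of_eventually h₂
  obtain ⟨η, hη, hlt⟩ := hlt
  obtain ⟨δ, hδ, hδ'⟩ : ∃ δ > 0, δ ≤ δ₁ ∧ δ ≤ δ₂ ∧ δ ≤ η ∧ δ ≤ δ₀ :=
    ⟨min (min δ₁ δ₂) (min η δ₀), by positivity, by simp, by simp, by simp, by simp⟩
  replace h₁ : ∀ t ∈ Ioc 0 δ, _ := fun t ht => h₁ t ⟨ht.1, ht.2.trans hδ'.1⟩
  replace h₂ : ∀ t ∈ Ioc 0 δ, _ := fun t ht => h₂ t ⟨ht.1, ht.2.trans hδ'.2.1⟩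
  replace hlt : ∀ u ∈ Ioc 0 δ, ∀ v ∈ Ioc 0 δ, x₁ u = x₂ v → y₂ v < y₁ u := fun u hu v hv =>
    hlt u ⟨hu.1, hu.2.trans hδ'.2.2.1⟩ v ⟨hv.1, hv.2.trans hδ'.2.2.1⟩
  obtain ⟨hl₁, g₁, hgx₁, hgc₁, hg₁, hgo₁, hgd₁⟩ :=
    exists_inverse_of_deriv_pos hδ hx₁ fun t ht => (h₁ t ht).1
  obtain ⟨hl₂, g₂, hgx₂, hgc₂, hg₂, hgo₂, hgd₂⟩ :=
    exists_inverse_of_deriv_pos hδ hx₂ fun t ht => (h₂ t ht).1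
  rw [← hx] at hl₂ hgc₂ hg₂ hgo₂ hgd₂
  set a := x₁ 0 with ha
  set b := min (x₁ δ) (x₂ δ) with hb
  have hab : a < b := lt_min hl₁ hl₂
  have hb₁ : b ≤ x₁ δ := min_le_left _ _
  have hb₂ : b ≤ x₂ δ := min_le_right _ _
  -- Height difference of the arcs over the common abscissa `ξ`. Since `dz/dx = y`, its derivative
  -- is `y₁ - y₂ > 0`; it increases strictly from `0`, so `H = ε` has exactly one root for small `ε
  -- > 0`.
  set H : ℝ → ℝ := fun ξ => z₁ (g₁ ξ) - z₂ (g₂ ξ) with hH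
  have hHc : ContinuousOn H (Icc a b) :=
    (hz₁.continuous.comp_continuousOn (hgc₁.mono (Icc_subset_Icc_right hb₁))).sub
      (hz₂.continuous.comp_continuousOn (hgc₂.mono (Icc_subset_Icc_right hb₂)))
  have hHm : StrictMonoOn H (Icc a b) := by
    refine strictMonoOn_of_deriv_pos (convex_Icc a b) hHc fun ξ hξ => ?_
    rw [interior_Icc] at hξ
    have hξ₁ : ξ ∈ Ioo a (x₁ δ) := ⟨hξ.1, hξ.2.trans_le hb₁⟩
    have hξ₂ : ξ ∈ Ioo a (x₂ δ) := ⟨hξ.1, hξ.2.trans_le hb₂⟩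
    have e₁ := hgo₁ ξ hξ₁
    have e₂ := hgo₂ ξ hξ₂
    have d₁ := (hz₁ (g₁ ξ)).hasDerivAt.comp ξ (hgd₁ ξ hξ₁)
    have d₂ := (hz₂ (g₂ ξ)).hasDerivAt.comp ξ (hgd₂ ξ hξ₂)
    obtain ⟨p₁, r₁⟩ := h₁ (g₁ ξ) ⟨e₁.1, e₁.2.le⟩
    obtain ⟨p₂, r₂⟩ := h₂ (g₂ ξ) ⟨e₂.1, e₂.2.le⟩
    rw [r₁, mul_assoc, mul_inv_cancel₀ p₁.ne', mul_one] at d₁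
    rw [r₂, mul_assoc, mul_inv_cancel₀ p₂.ne', mul_one] at d₂
    have d : HasDerivAt H (y₁ (g₁ ξ) - y₂ (g₂ ξ)) ξ := d₁.sub d₂
    rw [d.deriv, sub_pos]
    exact hlt _ ⟨e₁.1, e₁.2.le⟩ _ ⟨e₂.1, e₂.2.le⟩
      ((hg₁ ξ ⟨hξ₁.1.le, hξ₁.2.le⟩).2.trans (hg₂ ξ ⟨hξ₂.1.le, hξ₂.2.le⟩).2.symm)
  have haI : a ∈ Icc a b := ⟨le_rfl, hab.le⟩
  have hg0₁ : g₁ a = 0 := hgx₁ 0 ⟨le_rfl, hδ.le⟩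
  have hg0₂ : g₂ a = 0 := by rw [hx]; exact hgx₂ 0 ⟨le_rfl, hδ.le⟩
  have hHa : H a = 0 := by simp [hH, hg0₁, hg0₂, hz]
  have hHb : 0 < H b := hHa ▸ hHm haI ⟨hab.le, le_rfl⟩ hab
  have hex : ∀ ε, 0 < ε → ε < H b → ∃ ξ ∈ Ioo a b, H ξ = ε := by
    intro ε h0 h1
    exact intermediate_value_Ioo hab.le hHc ⟨hHa ▸ h0, h1⟩
  choose! Ξ hΞ hHΞ using hex
  have hsmall : ∀ᶠ ε in 𝓝[>] (0 : ℝ), 0 < ε ∧ ε < H b := by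
    filter_upwards [Ioo_mem_nhdsGT hHb] with ε hε using hε
  have hΞt : Tendsto Ξ (𝓝[>] 0) (𝓝[>] a) := by
    refine tendsto_nhdsWithin_iff.2 ⟨?_, ?_⟩
    · refine tendsto_order.2 ⟨fun c hc => ?_, fun c hc => ?_⟩
      · filter_upwards [hsmall] with ε hε using hc.trans (hΞ ε hε.1 hε.2).1
      · set c' := min c b with hc'
        have hac' : a < c' := lt_min hc hab
        have hcI : c' ∈ Icc a b := ⟨hac'.le, min_le_right _ _⟩
        have hpos : 0 < H c' := hHa ▸ hHm haI hcI hac'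
        filter_upwards [hsmall, Ioo_mem_nhdsGT hpos] with ε hε hε'
        have hI := hΞ ε hε.1 hε.2
        refine lt_of_lt_of_le ?_ (min_le_left c b)
        refine (hHm.lt_iff_lt ⟨hI.1.le, hI.2.le⟩ hcI).1 ?_
        rw [hHΞ ε hε.1 hε.2]
        exact hε'.2
    · filter_upwards [hsmall] with ε hε using (hΞ ε hε.1 hε.2).1
  have hgt : ∀ {g : ℝ → ℝ} {c : ℝ}, a < c → ContinuousOn g (Icc a c) → g a = 0 →
      Tendsto g (𝓝[>] a) (𝓝 0) := by
    intro g c hac hgc hga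
    rw [← hga]
    have := (hgc a ⟨le_rfl, hac.le⟩).mono Ioo_subset_Icc_self
    rwa [ContinuousWithinAt, nhdsWithin_Ioo_eq_nhdsGT hac] at this
  have key : ∀ u ∈ Ico 0 δ, ∀ v ∈ Ico 0 δ, x₁ u = x₂ v →
      x₁ u ∈ Icc a b ∧ g₁ (x₁ u) = u ∧ g₂ (x₁ u) = v := by
    intro u hu v hv huv
    have hu' : u ∈ Icc 0 δ := ⟨hu.1, hu.2.le⟩
    have hv' : v ∈ Icc 0 δ := ⟨hv.1, hv.2.le⟩
    have m₁ : MonotoneOn x₁ (Icc 0 δ) := by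
      refine monotoneOn_of_deriv_nonneg (convex_Icc 0 δ) hx₁.continuous.continuousOn
        hx₁.differentiableOn fun t ht => ?_
      rw [interior_Icc] at ht
      exact (h₁ t ⟨ht.1, ht.2.le⟩).1.le
    have m₂ : MonotoneOn x₂ (Icc 0 δ) := by
      refine monotoneOn_of_deriv_nonneg (convex_Icc 0 δ) hx₂.continuous.continuousOn
        hx₂.differentiableOn fun t ht => ?_
      rw [interior_Icc] at ht
      exact (h₂ t ⟨ht.1, ht.2.le⟩).1.le
    refine ⟨⟨m₁ ⟨le_rfl, hδ.le⟩ hu' hu.1, le_min (m₁ hu' ⟨hδ.le, le_rfl⟩ hu.2.le) ?_⟩,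
      hgx₁ u hu', ?_⟩
    · rw [huv]
      exact m₂ hv' ⟨hδ.le, le_rfl⟩ hv.2.le
    · rw [huv]
      exact hgx₂ v hv'
  refine ⟨fun ε => (g₁ (Ξ ε), g₂ (Ξ ε)),
    ((hgt hl₁ hgc₁ hg0₁).comp hΞt).prodMk_nhds ((hgt hl₂ hgc₂ hg0₂).comp hΞt),
    δ, hδ, hδ'.2.2.2, ?_, ?_, fun u hu v hv huv => ?_, fun u hu v hv huv => ?_⟩
  · filter_upwards [hsmall] with ε hε
    have hI := hΞ ε hε.1 hε.2
    have o₁ := hgo₁ _ ⟨hI.1, hI.2.trans_le hb₁⟩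
    have o₂ := hgo₂ _ ⟨hI.1, hI.2.trans_le hb₂⟩
    have e₁ := (hg₁ (Ξ ε) ⟨hI.1.le, hI.2.le.trans hb₁⟩).2
    have e₂ := (hg₂ (Ξ ε) ⟨hI.1.le, hI.2.le.trans hb₂⟩).2
    refine ⟨o₁, o₂, hlt _ ⟨o₁.1, o₁.2.le⟩ _ ⟨o₂.1, o₂.2.le⟩ (e₁.trans e₂.symm),
      (h₁ _ ⟨o₁.1, o₁.2.le⟩).1, (h₂ _ ⟨o₂.1, o₂.2.le⟩).1, fun u hu v hv => ?_⟩
    constructor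
    · rintro ⟨huv, hzz⟩
      obtain ⟨hm, hu', hv'⟩ := key u hu v hv huv
      have : x₁ u = Ξ ε := by
        refine hHm.injOn hm ⟨hI.1.le, hI.2.le⟩ ?_
        rw [hHΞ ε hε.1 hε.2]
        simp only [hH, hu', hv', hzz]
        ring
      rw [← this, hu', hv']
    · intro h
      obtain ⟨rfl, rfl⟩ := Prod.mk.inj h
      refine ⟨e₁.trans e₂.symm, ?_⟩
      have := hHΞ ε hε.1 hε.2
      simp only [hH] at this
      linarith
  · intro u hu v hv huv
    obtain ⟨hm, hu', hv'⟩ := key u hu v hv huv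
    have := hHm.monotoneOn haI hm hm.1
    rw [hHa] at this
    simp only [hH, hu', hv'] at this
    linarith
  · rw [← hgx₁ u ⟨hu.1, hu.2.le⟩, huv, hgx₁ v ⟨hv.1, hv.2.le⟩]
  · rw [← hgx₂ u ⟨hu.1, hu.2.le⟩, huv, hgx₂ v ⟨hv.1, hv.2.le⟩]

/-- Two arcs crossing transversely. -/
theorem exists_unique_pair_of_transverse {x₁ z₁ x₂ z₂ : ℝ → ℝ}
    (hx₁ : ContDiff ℝ 1 x₁) (hx₂ : ContDiff ℝ 1 x₂) (hz₁ : ContDiff ℝ 1 z₁) (hz₂ : ContDiff ℝ 1 z₂)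
    {s t : ℝ} (hx : x₁ s = x₂ t) (hz : z₁ s = z₂ t)
    (hdet : deriv x₁ s * deriv z₂ t - deriv x₂ t * deriv z₁ s ≠ 0) :
    ∃ q : ℝ → ℝ × ℝ, Tendsto q (𝓝[>] 0) (𝓝 (s, t)) ∧ ∃ U ∈ 𝓝 (s, t),
      ∀ᶠ ε in 𝓝[>] (0 : ℝ), q ε ∈ U ∧ ∀ p ∈ U,
        (x₁ p.1 = x₂ p.2 ∧ z₁ p.1 = z₂ p.2 + ε ↔ p = q ε) := by
  have hd : ∀ {f : ℝ → ℝ}, ContDiff ℝ 1 f → ∀ r, HasStrictDerivAt f (deriv f r) r :=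
    fun hf r => hf.contDiffAt.hasStrictDerivAt one_ne_zero
  -- The pairs sought solve `φ p = (0, ε)`. Up to sign the Jacobian of `φ` is the determinant in
  -- `hdet`, so `φ` is locally invertible.
  set φ : ℝ × ℝ → ℝ × ℝ := fun p => (x₁ p.1 - x₂ p.2, z₁ p.1 - z₂ p.2) with hφ
  let A : ℝ × ℝ →L[ℝ] ℝ × ℝ :=
    (deriv x₁ s • ContinuousLinearMap.fst ℝ ℝ ℝ - deriv x₂ t • ContinuousLinearMap.snd ℝ ℝ ℝ).prod
    (deriv z₁ s • ContinuousLinearMap.fst ℝ ℝ ℝ - deriv z₂ t • ContinuousLinearMap.snd ℝ ℝ ℝ)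
  have hA : HasStrictFDerivAt φ A (s, t) := by
    have e : ∀ {f g : ℝ → ℝ}, ContDiff ℝ 1 f → ContDiff ℝ 1 g →
        HasStrictFDerivAt (fun p : ℝ × ℝ => f p.1 - g p.2)
          (deriv f s • ContinuousLinearMap.fst ℝ ℝ ℝ - deriv g t • ContinuousLinearMap.snd ℝ ℝ ℝ)
          (s, t) := by
      intro f g hf hg
      exact ((hd hf s).comp_hasStrictFDerivAt (s, t) hasStrictFDerivAt_fst).sub
        ((hd hg t).comp_hasStrictFDerivAt (s, t) hasStrictFDerivAt_snd)
    exact (e hx₁ hx₂).prodMk (e hz₁ hz₂)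
  have hinj : Function.Injective (A : ℝ × ℝ →ₗ[ℝ] ℝ × ℝ) := by
    rw [injective_iff_map_eq_zero]
    rintro ⟨u, v⟩ huv
    have e1 : deriv x₁ s * u - deriv x₂ t * v = 0 := congrArg Prod.fst huv
    have e2 : deriv z₁ s * u - deriv z₂ t * v = 0 := congrArg Prod.snd huv
    have hu : (deriv x₁ s * deriv z₂ t - deriv x₂ t * deriv z₁ s) * u = 0 := by
      linear_combination deriv z₂ t * e1 - deriv x₂ t * e2
    have hv : (deriv x₁ s * deriv z₂ t - deriv x₂ t * deriv z₁ s) * v = 0 := by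
      linear_combination deriv z₁ s * e1 - deriv x₁ s * e2
    rw [(mul_eq_zero.1 hu).resolve_left hdet, (mul_eq_zero.1 hv).resolve_left hdet]
    rfl
  let E : (ℝ × ℝ) ≃L[ℝ] ℝ × ℝ :=
    (LinearEquiv.ofInjectiveEndo (A : ℝ × ℝ →ₗ[ℝ] ℝ × ℝ) hinj).toContinuousLinearEquiv
  have hE : HasStrictFDerivAt φ (E : ℝ × ℝ →L[ℝ] ℝ × ℝ) (s, t) := by
    convert hA using 1
    ext <;> rfl
  set R := hE.toOpenPartialHomeomorph φ with hR
  have hRφ : ∀ p, R p = φ p := fun p => rfl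
  have hφ0 : φ (s, t) = (0, 0) := by simp [hφ, hx, hz]
  have hsrc : (s, t) ∈ R.source := hE.mem_toOpenPartialHomeomorph_source
  have htgt : ((0 : ℝ), (0 : ℝ)) ∈ R.target := hφ0 ▸ hE.image_mem_toOpenPartialHomeomorph_target
  have hpath : Tendsto (fun ε : ℝ => ((0 : ℝ), ε)) (𝓝[>] 0) (𝓝 (0, 0)) :=
    ((continuous_const.prodMk continuous_id).tendsto 0).mono_left nhdsWithin_le_nhds
  refine ⟨fun ε => R.symm (0, ε), ?_, R.source, R.open_source.mem_nhds hsrc, ?_⟩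
  · have := R.continuousAt_symm htgt
    have e : R.symm (0, 0) = (s, t) := by rw [← hφ0, ← hRφ, R.left_inv hsrc]
    rw [ContinuousAt, e] at this
    exact this.comp hpath
  · filter_upwards [hpath (R.open_target.mem_nhds htgt)] with ε hε
    refine ⟨R.map_target hε, fun p hp => ?_⟩
    have : p = R.symm (0, ε) ↔ φ p = (0, ε) := by
      constructor
      · rintro rfl
        rw [← hRφ, R.right_inv hε]
      · intro h
        rw [← h, ← hRφ, R.left_inv hp]
    rw [this, hφ, Prod.mk.injEq, sub_eq_zero, sub_eq_iff_eq_add']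

/-! ### Legendrian arcs in space -/

section Curves

variable {c c₁ c₂ : ℝ → Space}

theorem hasDerivAt_coord (hc : ContDiff ℝ ∞ c) (i : Fin 3) (t : ℝ) :
    HasDerivAt (fun t => c t i) (deriv c t i) t :=
  (EuclideanSpace.proj (𝕜 := ℝ) i).hasFDerivAt.comp_hasDerivAt t
    ((hc.differentiable (by simp)) t).hasDerivAt

theorem contDiff_coord (hc : ContDiff ℝ ∞ c) (i : Fin 3) : ContDiff ℝ ∞ fun t => c t i :=
  (EuclideanSpace.proj (𝕜 := ℝ) i).contDiff.comp hc

theorem differentiable_coord (hc : ContDiff ℝ ∞ c) (i : Fin 3) : Differentiable ℝ fun t => c t i :=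
  fun t => (hasDerivAt_coord hc i t).differentiableAt

theorem deriv_coord (hc : ContDiff ℝ ∞ c) (i : Fin 3) (t : ℝ) :
    deriv (fun t => c t i) t = deriv c t i := (hasDerivAt_coord hc i t).deriv

theorem contDiff_deriv (hc : ContDiff ℝ ∞ c) : ContDiff ℝ ∞ (deriv c) :=
  (contDiff_infty_iff_deriv.1 hc).2

theorem eventually_pos_of_hasDerivAt_pos {f : ℝ → ℝ} {f' : ℝ} (hf : HasDerivAt f f' 0)
    (h0 : f 0 = 0) (hf' : 0 < f') : ∀ᶠ u in 𝓝[>] (0 : ℝ), 0 < f u := by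
  have h := (hasDerivAt_iff_tendsto_slope.1 hf).mono_left
    (nhdsWithin_mono 0 fun u (hu : (0 : ℝ) < u) => hu.ne')
  filter_upwards [h.eventually (lt_mem_nhds hf'), self_mem_nhdsWithin] with u hu hu0
  rw [slope_def_field, h0, sub_zero, sub_zero] at hu
  exact (div_pos_iff_of_pos_right hu0).1 hu

/-- The velocity of the curve at time `t` lies in the contact plane. -/
def TangentAt (c : ℝ → Space) (t : ℝ) : Prop := deriv c t 2 = c t 1 * deriv c t 0

/-- Two Legendrian arcs leave their common starting point to the same side in the front, the
first one being above the second one. -/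
def Wedge (c₁ c₂ : ℝ → Space) : Prop :=
  ∃ σ : ℝ, σ * σ = 1 ∧
    (∀ᶠ t in 𝓝[>] (0 : ℝ), 0 < σ * deriv c₁ t 0 ∧ TangentAt c₁ t) ∧
    (∀ᶠ t in 𝓝[>] (0 : ℝ), 0 < σ * deriv c₂ t 0 ∧ TangentAt c₂ t) ∧
    ∃ η > 0, ∀ u ∈ Ioc (0 : ℝ) η, ∀ v ∈ Ioc (0 : ℝ) η, c₁ u 0 = c₂ v 0 →
      σ * c₂ v 1 < σ * c₁ u 1

/-- For small `ε`, exactly one pair of points of the two arcs near their starting points has the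
same `x` and differs by `ε` in `z`. -/
structure UniquePair (c₁ c₂ : ℝ → Space) (δ : ℝ) (q : ℝ → ℝ × ℝ) : Prop where
  pos : 0 < δ
  tendsto : Tendsto q (𝓝[>] 0) (𝓝 (0, 0))
  injOn_left : InjOn (fun t => c₁ t 0) (Ico 0 δ)
  injOn_right : InjOn (fun t => c₂ t 0) (Ico 0 δ)
  le : ∀ u ∈ Ico 0 δ, ∀ v ∈ Ico 0 δ, c₁ u 0 = c₂ v 0 → c₂ v 2 ≤ c₁ u 2
  eventually : ∀ᶠ ε in 𝓝[>] (0 : ℝ), (q ε).1 ∈ Ioo 0 δ ∧ (q ε).2 ∈ Ioo 0 δ ∧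
    c₁ (q ε).1 1 ≠ c₂ (q ε).2 1 ∧ 0 < deriv c₁ (q ε).1 0 * deriv c₂ (q ε).2 0 ∧
    ∀ u ∈ Ico 0 δ, ∀ v ∈ Ico 0 δ, (c₁ u 0 = c₂ v 0 ∧ c₁ u 2 = c₂ v 2 + ε ↔ (u, v) = q ε)

/-- The substitution `(x, y) ↦ (σx, σy)` preserves `dz = y dx` and makes both arcs run to the right.
-/
theorem Wedge.uniquePair (h : Wedge c₁ c₂) (h₁ : ContDiff ℝ ∞ c₁) (h₂ : ContDiff ℝ ∞ c₂)
    (h0 : c₁ 0 = c₂ 0) {δ₀ : ℝ} (hδ₀ : 0 < δ₀) : ∃ q, ∃ δ ≤ δ₀, UniquePair c₁ c₂ δ q := by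
  obtain ⟨σ, hσ, t₁, t₂, hlt⟩ := h
  have hσ0 : σ ≠ 0 := by rintro rfl; simp at hσ
  have hd : ∀ {c : ℝ → Space}, ContDiff ℝ ∞ c → ∀ t,
      HasDerivAt (fun t => σ * c t 0) (σ * deriv c t 0) t := fun hc t =>
    (hasDerivAt_coord hc 0 t).const_mul σ
  have hev : ∀ {c : ℝ → Space}, ContDiff ℝ ∞ c →
      (∀ᶠ t in 𝓝[>] (0 : ℝ), 0 < σ * deriv c t 0 ∧ TangentAt c t) →
      ∀ᶠ t in 𝓝[>] (0 : ℝ), 0 < deriv (fun t => σ * c t 0) t ∧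
        deriv (fun t => c t 2) t = (σ * c t 1) * deriv (fun t => σ * c t 0) t := by
    intro c hc hc'
    filter_upwards [hc'] with t ht
    rw [(hd hc t).deriv, deriv_coord hc]
    refine ⟨ht.1, ?_⟩
    rw [ht.2]
    linear_combination -(c t 1 * deriv c t 0) * hσ
  obtain ⟨q, hq, δ, hδ, hδ', hev', hle, hi₁, hi₂⟩ :=
    exists_unique_pair_of_wedge (x₁ := fun t => σ * c₁ t 0) (y₁ := fun t => σ * c₁ t 1)
      (z₁ := fun t => c₁ t 2) (x₂ := fun t => σ * c₂ t 0) (y₂ := fun t => σ * c₂ t 1)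
      (z₂ := fun t => c₂ t 2) (fun t => (hd h₁ t).differentiableAt)
      (fun t => (hd h₂ t).differentiableAt) (differentiable_coord h₁ 2) (differentiable_coord h₂ 2)
      (by simp [h0]) (by simp [h0]) (hev h₁ t₁) (hev h₂ t₂)
      (by simpa only [mul_right_inj' hσ0] using hlt) hδ₀
  simp only [mul_right_inj' hσ0] at hev' hle
  refine ⟨q, δ, hδ', hδ, hq, fun u hu v hv huv => hi₁ hu hv ?_, fun u hu v hv huv => hi₂ hu hv ?_,
    hle, ?_⟩
  · exact congrArg (σ * ·) huv
  · exact congrArg (σ * ·) huv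
  · filter_upwards [hev'] with ε hε
    refine ⟨hε.1, hε.2.1, fun h => hε.2.2.1.ne' (by rw [h]), ?_, hε.2.2.2.2.2⟩
    have := mul_pos hε.2.2.2.1 hε.2.2.2.2.1
    rw [(hd h₁ _).deriv, (hd h₂ _).deriv] at this
    linear_combination this + (deriv c₁ (q ε).1 0 * deriv c₂ (q ε).2 0) * hσ

/-- In the front both arcs start with the same slope `y`, so their order is decided by `dy/dx`. In
the `(x, y)`-plane a line of intermediate slope `m` through the common point separates the two arcs,
which orders their `y` over equal `x`. -/
theorem wedge_of_slope_lt (h₁ : ContDiff ℝ ∞ c₁) (h₂ : ContDiff ℝ ∞ c₂) (h0 : c₁ 0 = c₂ 0)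
    (t₁ : ∀ t ∈ Ioo (0 : ℝ) 1, TangentAt c₁ t) (t₂ : ∀ t ∈ Ioo (0 : ℝ) 1, TangentAt c₂ t)
    (hx : 0 < deriv c₁ 0 0 * deriv c₂ 0 0)
    (hm : deriv c₂ 0 1 / deriv c₂ 0 0 < deriv c₁ 0 1 / deriv c₁ 0 0) : Wedge c₁ c₂ := by
  obtain ⟨σ, hσ, hσ₁, hσ₂⟩ : ∃ σ : ℝ, σ * σ = 1 ∧ 0 < σ * deriv c₁ 0 0 ∧ 0 < σ * deriv c₂ 0 0 := by
    rcases mul_pos_iff.1 hx with h | h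
    · exact ⟨1, by simpa using h⟩
    · exact ⟨-1, by simpa using h⟩
  have hpos : ∀ {c : ℝ → Space}, ContDiff ℝ ∞ c → 0 < σ * deriv c 0 0 →
      (∀ t ∈ Ioo (0 : ℝ) 1, TangentAt c t) →
      ∀ᶠ t in 𝓝[>] (0 : ℝ), 0 < σ * deriv c t 0 ∧ TangentAt c t := by
    intro c hc hσc ht
    have hcont : Continuous fun t => σ * deriv c t 0 :=
      continuous_const.mul (contDiff_coord (contDiff_deriv hc) 0).continuous
    filter_upwards [nhdsWithin_le_nhds (hcont.continuousAt.eventually (lt_mem_nhds hσc)),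
      Ioo_mem_nhdsGT one_pos] with t h1 h2 using ⟨h1, ht t h2⟩
  obtain ⟨m, hm₂, hm₁⟩ := exists_between hm
  have hlin : ∀ {c : ℝ → Space} (τ : ℝ), ContDiff ℝ ∞ c →
      0 < τ * (deriv c 0 1 - m * deriv c 0 0) →
      ∀ᶠ u in 𝓝[>] (0 : ℝ), 0 < τ * ((c u 1 - c 0 1) - m * (c u 0 - c 0 0)) := by
    intro c τ hc hτ
    refine eventually_pos_of_hasDerivAt_pos (f' := τ * (deriv c 0 1 - m * deriv c 0 0)) ?_
      (by simp) hτ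
    exact (((hasDerivAt_coord hc 1 0).sub_const _).sub
      (((hasDerivAt_coord hc 0 0).sub_const _).const_mul m)).const_mul τ
  have e₁ : 0 < σ * (deriv c₁ 0 1 - m * deriv c₁ 0 0) := by
    have hne : deriv c₁ 0 0 ≠ 0 := right_ne_zero_of_mul hσ₁.ne'
    have : σ * (deriv c₁ 0 1 - m * deriv c₁ 0 0) =
        (σ * deriv c₁ 0 0) * (deriv c₁ 0 1 / deriv c₁ 0 0 - m) := by field_simp
    rw [this]
    exact mul_pos hσ₁ (sub_pos.2 hm₁)
  have e₂ : 0 < -σ * (deriv c₂ 0 1 - m * deriv c₂ 0 0) := by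
    have hne : deriv c₂ 0 0 ≠ 0 := right_ne_zero_of_mul hσ₂.ne'
    have : -σ * (deriv c₂ 0 1 - m * deriv c₂ 0 0) =
        (σ * deriv c₂ 0 0) * (m - deriv c₂ 0 1 / deriv c₂ 0 0) := by field_simp; ring
    rw [this]
    exact mul_pos hσ₂ (sub_pos.2 hm₂)
  obtain ⟨η, hη, hη'⟩ := exists_forall_Ioc_of_eventually ((hlin σ h₁ e₁).and (hlin (-σ) h₂ e₂))
  refine ⟨σ, hσ, hpos h₁ hσ₁ t₁, hpos h₂ hσ₂ t₂, η, hη, fun u hu v hv huv => ?_⟩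
  have a₁ := (hη' u hu).1
  have a₂ := (hη' v hv).2
  rw [huv, h0] at a₁
  linarith

/-- The two branches of a semicubical cusp. -/
theorem wedge_of_cusp (hc : ContDiff ℝ ∞ c) {t₀ : ℝ} (ht : ∀ᶠ t in 𝓝 t₀, TangentAt c t)
    (hx : deriv c t₀ 0 = 0) (hxx : deriv (deriv c) t₀ 0 ≠ 0) (hy : deriv c t₀ 1 ≠ 0) :
    ∃ e : ℝ, e * e = 1 ∧ Wedge (fun u => c (t₀ + e * u)) (fun u => c (t₀ - e * u)) := by
  obtain ⟨σ, hσ, hσx⟩ : ∃ σ : ℝ, σ * σ = 1 ∧ 0 < σ * deriv (deriv c) t₀ 0 := by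
    rcases lt_or_gt_of_ne hxx with h | h
    · exact ⟨-1, by simpa using h⟩
    · exact ⟨1, by simpa using h⟩
  -- The sign `σ` of `x''` tells to which side the cusp opens. The sign `e` is chosen so that `σy`
  -- increases along `u ↦ t₀ + e u`, which makes this the upper branch.
  obtain ⟨e, he, hey⟩ : ∃ e : ℝ, e * e = 1 ∧ 0 < e * (σ * deriv c t₀ 1) := by
    have : σ * deriv c t₀ 1 ≠ 0 := mul_ne_zero (by rintro rfl; simp at hσ) hy
    rcases lt_or_gt_of_ne this with h | h
    · exact ⟨-1, by simpa using h⟩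
    · exact ⟨1, by simpa using h⟩
  have hline : ∀ a u : ℝ, HasDerivAt (fun u => t₀ + a * u) a u := fun a u => by
    simpa using ((hasDerivAt_id u).const_mul a).const_add t₀
  have hcomp : ∀ {f : ℝ → Space} (_ : ContDiff ℝ ∞ f) (i : Fin 3) (a u : ℝ),
      HasDerivAt (fun u => f (t₀ + a * u) i) (deriv f (t₀ + a * u) i * a) u := fun hf i a u =>
    (hasDerivAt_coord hf i _).comp u (hline a u)
  have hbr : ∀ a : ℝ, ContDiff ℝ ∞ fun u => c (t₀ + a * u) := fun a =>
    hc.comp (contDiff_const.add (contDiff_const.mul contDiff_id))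
  have hder : ∀ (a u : ℝ) (i : Fin 3),
      deriv (fun u => c (t₀ + a * u)) u i = deriv c (t₀ + a * u) i * a := fun a u i => by
    rw [← deriv_coord (hbr a)]
    exact (hcomp hc i a u).deriv
  have hpos : ∀ a : ℝ, a * a = 1 → ∀ᶠ u in 𝓝[>] (0 : ℝ),
      0 < σ * deriv (fun u => c (t₀ + a * u)) u 0 ∧ TangentAt (fun u => c (t₀ + a * u)) u := by
    intro a ha
    have hev : ∀ᶠ u in 𝓝[>] (0 : ℝ), 0 < σ * a * deriv c (t₀ + a * u) 0 := by
      refine eventually_pos_of_hasDerivAt_pos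
        ((hcomp (contDiff_deriv hc) 0 a 0).const_mul (σ * a)) (by simp [hx]) ?_
      rw [mul_zero, add_zero]
      linear_combination hσx - (σ * deriv (deriv c) t₀ 0) * ha
    have hlim : Tendsto (fun u : ℝ => t₀ + a * u) (𝓝[>] 0) (𝓝 t₀) := by
      have := (hline a 0).continuousAt.tendsto
      simp only [mul_zero, add_zero] at this
      exact this.mono_left nhdsWithin_le_nhds
    filter_upwards [hev, hlim.eventually ht] with u hu hu'
    refine ⟨?_, ?_⟩
    · rw [hder]
      linarith
    · rw [TangentAt] at hu' ⊢
      rw [hder, hder, hu', mul_assoc]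
  have hyp : ∀ᶠ u in 𝓝[>] (0 : ℝ), 0 < σ * (c (t₀ + e * u) 1 - c t₀ 1) := by
    refine eventually_pos_of_hasDerivAt_pos (((hcomp hc 1 e 0).sub_const _).const_mul σ)
      (by simp) ?_
    rw [mul_zero, add_zero]
    linarith
  have hyn : ∀ᶠ u in 𝓝[>] (0 : ℝ), 0 < -σ * (c (t₀ + -e * u) 1 - c t₀ 1) := by
    refine eventually_pos_of_hasDerivAt_pos (((hcomp hc 1 (-e) 0).sub_const _).const_mul (-σ))
      (by simp) ?_
    rw [mul_zero, add_zero]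
    linarith
  obtain ⟨η, hη, hη'⟩ := exists_forall_Ioc_of_eventually
    (hyp.and hyn)
  have hneg : (fun u => c (t₀ - e * u)) = fun u => c (t₀ + -e * u) := by
    ext1 u; congr 1; ring
  refine ⟨e, he, σ, hσ, hpos e he, ?_, η, hη, fun u hu v hv _ => ?_⟩
  · rw [hneg]
    exact hpos (-e) (by linarith)
  · have a₁ := (hη' u hu).1
    have a₂ := (hη' v hv).2
    have : c (t₀ - e * v) = c (t₀ + -e * v) := congrFun hneg v
    simp only [this]
    linarith

end Curves

/-! ### Local counts of pairs of points of two arcs -/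

/-- Serves the substitution `t ↦ 1 - t`, by which the end of an edge becomes the start of the
reversed edge. -/
theorem HasLocalIndex.homeomorph {X Y : Type*} [TopologicalSpace X] [TopologicalSpace Y]
    {Sol : ℝ → Set X} {w : X → ℤ} {Sol' : ℝ → Set Y} {w' : Y → ℤ} {p : X} {k : ℤ}
    (h : HasLocalIndex Sol w p k) (e : X ≃ₜ Y) (hSol : ∀ ε x, e x ∈ Sol' ε ↔ x ∈ Sol ε)
    (hw : ∀ x, w' (e x) = w x) : HasLocalIndex Sol' w' (e p) k := by
  obtain ⟨U, hU, h⟩ := h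
  refine ⟨e '' U, e.isOpenMap.image_mem_nhds hU, fun V hV hVU => ?_⟩
  have hV' : e ⁻¹' V ∈ 𝓝 p := e.continuous.continuousAt hV
  filter_upwards [h (e ⁻¹' V) hV' (by
    intro x hx
    obtain ⟨y, hy, hyx⟩ := hVU hx
    rwa [← e.injective hyx])] with ε hε
  have himg : Sol' ε ∩ V = e '' (Sol ε ∩ e ⁻¹' V) := by
    ext y
    obtain ⟨x, rfl⟩ := e.surjective y
    rw [e.injective.mem_set_image]
    exact and_congr_left fun _ => hSol ε x
  rw [himg]
  refine ⟨hε.1.image e, ?_⟩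
  rw [finsum_mem_image e.injective.injOn]
  simpa only [hw] using hε.2

section FrontPairs

variable {c c₁ c₂ : ℝ → Space} {I J : Set ℝ}

/-- The pairs of parameters of points of two arcs with the same `x`, at different points of the
`y`-axis, the first one higher than the second one by `ε` in the `z`-direction. -/
def frontPairs (c₁ c₂ : ℝ → Space) (I J : Set ℝ) (ε : ℝ) : Set (ℝ × ℝ) :=
  {p | p.1 ∈ I ∧ p.2 ∈ J ∧ c₁ p.1 0 = c₂ p.2 0 ∧ c₁ p.1 2 = c₂ p.2 2 + ε ∧ c₁ p.1 1 ≠ c₂ p.2 1}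

/-- Whether two arcs run in the same direction along the `x`-axis. -/
noncomputable def pairSign (c₁ c₂ : ℝ → Space) (p : ℝ × ℝ) : ℤ :=
  (SignType.sign (deriv c₁ p.1 0 * deriv c₂ p.2 0) : ℤ)

/-- If the `x` differ, they do so nearby; if only the `z` differ, the gap stays above half its
value, which exceeds a small `ε`. -/
theorem exists_nhds_frontPairs_eq_empty_of_ne (h₁ : ContDiff ℝ ∞ c₁) (h₂ : ContDiff ℝ ∞ c₂)
    {s t : ℝ} (h : front (c₁ s) ≠ front (c₂ t)) :
    ∃ U ∈ 𝓝 (s, t), ∀ᶠ ε in 𝓝[>] (0 : ℝ), frontPairs c₁ c₂ I J ε ∩ U = ∅ := by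
  have hc : ∀ i : Fin 3, Continuous fun p : ℝ × ℝ => c₁ p.1 i - c₂ p.2 i := fun i =>
    ((contDiff_coord h₁ i).continuous.comp continuous_fst).sub
      ((contDiff_coord h₂ i).continuous.comp continuous_snd)
  by_cases hx : c₁ s 0 = c₂ t 0
  · have hz : c₁ s 2 - c₂ t 2 ≠ 0 := fun hz => h (Prod.ext hx (sub_eq_zero.1 hz))
    have hpos : 0 < |c₁ s 2 - c₂ t 2| / 2 := by positivity
    refine ⟨{p | |c₁ s 2 - c₂ t 2| / 2 < |c₁ p.1 2 - c₂ p.2 2|},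
      ((hc 2).abs.isOpen_preimage _ isOpen_Ioi).mem_nhds (half_lt_self (abs_pos.2 hz)), ?_⟩
    filter_upwards [Ioo_mem_nhdsGT hpos] with ε hε
    rw [eq_empty_iff_forall_notMem]
    rintro p ⟨⟨-, -, -, hp, -⟩, hp'⟩
    rw [mem_ofPred_eq, hp, add_sub_cancel_left, abs_of_pos hε.1] at hp'
    exact lt_asymm hp' hε.2
  · refine ⟨{p | c₁ p.1 0 - c₂ p.2 0 ≠ 0},
      ((hc 0).isOpen_preimage _ isOpen_ne).mem_nhds (sub_ne_zero.2 hx), ?_⟩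
    refine .of_forall fun ε => ?_
    rw [eq_empty_iff_forall_notMem]
    rintro p ⟨⟨-, -, hp, -⟩, hp'⟩
    exact hp' (sub_eq_zero.2 hp)

theorem exists_nhds_injOn_coord_zero (hc : ContDiff ℝ ∞ c) {t : ℝ} (h : deriv c t 0 ≠ 0) :
    ∃ U ∈ 𝓝 t, InjOn (fun t => c t 0) U := by
  have hd : HasStrictDerivAt (fun t => c t 0) (deriv c t 0) t := by
    rw [← deriv_coord hc]
    exact (contDiff_coord hc 0).contDiffAt.hasStrictDerivAt (by simp)
  have hd' := hd.hasStrictFDerivAt_equiv h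
  exact ⟨_, (hd'.toOpenPartialHomeomorph _).open_source.mem_nhds
    hd'.mem_toOpenPartialHomeomorph_source, (hd'.toOpenPartialHomeomorph _).injOn⟩

/-- Near a regular point `x` is injective, so equal `x` forces equal parameters and hence equal `y`,
which `frontPairs` excludes. This disposes of the diagonal away from cusps. -/
theorem exists_nhds_frontPairs_eq_empty_of_regular (hc : ContDiff ℝ ∞ c) {t : ℝ}
    (h : deriv c t 0 ≠ 0) :
    ∃ U ∈ 𝓝 (t, t), ∀ᶠ ε in 𝓝[>] (0 : ℝ), frontPairs c c I J ε ∩ U = ∅ := by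
  obtain ⟨U, hU, hinj⟩ := exists_nhds_injOn_coord_zero hc h
  refine ⟨U ×ˢ U, prod_mem_nhds hU hU, .of_forall fun ε => ?_⟩
  rw [eq_empty_iff_forall_notMem]
  rintro p ⟨⟨-, -, hx, -, hy⟩, hp⟩
  exact hy (by rw [hinj hp.1 hp.2 hx])

/-- Strands with different `y` have different slopes `dz/dx` and are therefore transverse: the
determinant is `x₁' x₂' (y₂ - y₁)`. The crossing moves slightly and keeps its sign. -/
theorem hasLocalIndex_crossing (h₁ : ContDiff ℝ ∞ c₁) (h₂ : ContDiff ℝ ∞ c₂) {s t : ℝ}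
    (hI : I ∈ 𝓝 s) (hJ : J ∈ 𝓝 t) (hp : (s, t) ∈ frontPairs c₁ c₂ I J 0)
    (t₁ : TangentAt c₁ s) (t₂ : TangentAt c₂ t)
    (hx₁ : deriv c₁ s 0 ≠ 0) (hx₂ : deriv c₂ t 0 ≠ 0) :
    HasLocalIndex (frontPairs c₁ c₂ I J) (pairSign c₁ c₂) (s, t) (pairSign c₁ c₂ (s, t)) := by
  obtain ⟨-, -, hx, hz, hy⟩ := hp
  simp only [add_zero] at hx hz hy
  have hsm : ∀ {c : ℝ → Space}, ContDiff ℝ ∞ c → ∀ i : Fin 3, ContDiff ℝ 1 fun t => c t i :=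
    fun hc i => (contDiff_coord hc i).of_le (by simp)
  obtain ⟨q, hq, U, hU, hqU⟩ := exists_unique_pair_of_transverse (hsm h₁ 0) (hsm h₂ 0) (hsm h₁ 2)
    (hsm h₂ 2) hx hz (by
      rw [deriv_coord h₁, deriv_coord h₂, deriv_coord h₂, deriv_coord h₁, t₁, t₂]
      have : deriv c₁ s 0 * (c₂ t 1 * deriv c₂ t 0) - deriv c₂ t 0 * (c₁ s 1 * deriv c₁ s 0) =
        deriv c₁ s 0 * deriv c₂ t 0 * (c₂ t 1 - c₁ s 1) := by ring
      rw [this]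
      exact mul_ne_zero (mul_ne_zero hx₁ hx₂) (sub_ne_zero.2 hy.symm))
  have hcy : ContinuousAt (fun p : ℝ × ℝ => c₁ p.1 1 - c₂ p.2 1) (s, t) :=
    (((contDiff_coord h₁ 1).continuous.comp continuous_fst).sub
      ((contDiff_coord h₂ 1).continuous.comp continuous_snd)).continuousAt
  have hcx : ContinuousAt (fun p : ℝ × ℝ => deriv c₁ p.1 0 * deriv c₂ p.2 0) (s, t) :=
    (((contDiff_coord (contDiff_deriv h₁) 0).continuous.comp continuous_fst).mul
      ((contDiff_coord (contDiff_deriv h₂) 0).continuous.comp continuous_snd)).continuousAt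
  have hsgn : ∀ᶠ p in 𝓝 (s, t), pairSign c₁ c₂ p = pairSign c₁ c₂ (s, t) := by
    rcases lt_or_gt_of_ne (mul_ne_zero hx₁ hx₂) with h | h
    · filter_upwards [hcx.eventually (gt_mem_nhds h)] with p hp
      rw [pairSign, pairSign, sign_neg hp, sign_neg h]
    · filter_upwards [hcx.eventually (lt_mem_nhds h)] with p hp
      rw [pairSign, pairSign, sign_pos hp, sign_pos h]
  refine .of_singleton hU hq ?_
  filter_upwards [hqU, hq.eventually hsgn, hq (prod_mem_nhds hI hJ),
    hq.eventually (hcy.eventually_ne (sub_ne_zero.2 hy))] with ε h h' hIJ hyq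
  refine ⟨?_, h'⟩
  ext p
  rw [mem_singleton_iff]
  constructor
  · rintro ⟨⟨-, -, h1, h2, -⟩, hpU⟩
    exact (h.2 p hpU).1 ⟨h1, h2⟩
  · rintro rfl
    have := (h.2 _ h.1).2 rfl
    exact ⟨⟨hIJ.1, hIJ.2, this.1, this.2, sub_ne_zero.1 hyq⟩, h.1⟩

/-- The only solution pairs a point of the upper branch with one of the lower branch. One branch
runs towards the cusp and the other away from it, so the `x`-velocities have opposite signs. -/
theorem hasLocalIndex_cusp (hc : ContDiff ℝ ∞ c) {t₀ : ℝ} (hI : I ∈ 𝓝 t₀) (hJ : J ∈ 𝓝 t₀)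
    (ht : ∀ᶠ t in 𝓝 t₀, TangentAt c t) (hx : deriv c t₀ 0 = 0)
    (hxx : deriv (deriv c) t₀ 0 ≠ 0) (hy : deriv c t₀ 1 ≠ 0) :
    HasLocalIndex (frontPairs c c I J) (pairSign c c) (t₀, t₀) (-1) := by
  obtain ⟨e, he, hW⟩ := wedge_of_cusp hc ht hx hxx hy
  have hbr : ∀ a : ℝ, ContDiff ℝ ∞ fun u => c (t₀ + a * u) := fun a =>
    hc.comp (contDiff_const.add (contDiff_const.mul contDiff_id))
  have hneg : (fun u => c (t₀ - e * u)) = fun u => c (t₀ + -e * u) := by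
    ext1 u; congr 1; ring
  have hder : ∀ a u : ℝ, deriv (fun u => c (t₀ + a * u)) u 0 = deriv c (t₀ + a * u) 0 * a := by
    intro a u
    rw [← deriv_coord (hbr a)]
    have hl : HasDerivAt (fun u => t₀ + a * u) a u := by
      simpa using ((hasDerivAt_id u).const_mul a).const_add t₀
    exact ((hasDerivAt_coord hc 0 _).comp u hl).deriv
  obtain ⟨q, δ, -, hq⟩ := hW.uniquePair (hbr e) (hneg ▸ hbr (-e)) (by simp) one_pos
  have habs : ∀ r : ℝ, |e * r| = |r| := fun r => by
    have : |e| = 1 := by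
      have h : |e| * |e| = 1 := by rw [← abs_mul, he, abs_one]
      nlinarith [abs_nonneg e]
    rw [abs_mul, this, one_mul]
  have hqt : Tendsto (fun ε => (t₀ + e * (q ε).1, t₀ - e * (q ε).2)) (𝓝[>] 0) (𝓝 (t₀, t₀)) := by
    have h1 : Continuous fun p : ℝ × ℝ => (t₀ + e * p.1, t₀ - e * p.2) := by fun_prop
    have h2 := (h1.tendsto (0, 0)).comp hq.tendsto
    simp only [mul_zero, add_zero, sub_zero] at h2
    exact h2
  have hU : {p : ℝ × ℝ | |p.1 - t₀| < δ ∧ |p.2 - t₀| < δ} ∈ 𝓝 (t₀, t₀) := by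
    refine IsOpen.mem_nhds ?_ (by simp [hq.pos])
    exact (isOpen_lt (continuous_fst.sub continuous_const).abs continuous_const).inter
      (isOpen_lt (continuous_snd.sub continuous_const).abs continuous_const)
  refine .of_singleton hU hqt ?_
  filter_upwards [hq.eventually, self_mem_nhdsWithin, hqt (prod_mem_nhds hI hJ)] with ε h hε hIJ
  obtain ⟨h1, h2, hyy, hxx', huv⟩ := h
  have hsol := (huv _ ⟨h1.1.le, h1.2⟩ _ ⟨h2.1.le, h2.2⟩).2 rfl
  refine ⟨?_, ?_⟩
  · ext ⟨s, t⟩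
    rw [mem_singleton_iff]
    constructor
    · rintro ⟨⟨-, -, hx', hz', hy'⟩, hs, ht⟩
      simp only at hx' hz' hy' hs ht
      set a := e * (s - t₀) with ha
      set b := e * (t - t₀) with hb
      have hsa : s = t₀ + e * a := by rw [ha]; linear_combination -(s - t₀) * he
      have htb : t = t₀ + e * b := by rw [hb]; linear_combination -(t - t₀) * he
      have hsa' : s = t₀ - e * (-a) := by rw [hsa]; ring
      have htb' : t = t₀ - e * (-b) := by rw [htb]; ring
      rw [← habs] at hs ht
      obtain ⟨hs1, hs2⟩ := abs_lt.1 hs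
      obtain ⟨ht1, ht2⟩ := abs_lt.1 ht
      -- Nonnegative `a` or `b` means the upper branch. Two points of one branch with equal `x`
      -- coincide; a lower point paired with an upper one would have height difference at most `0 <
      -- ε`. Only upper with lower remains.
      rcases le_total 0 a with h0a | h0a <;> rcases le_total 0 b with h0b | h0b
      · have : a = b := hq.injOn_left ⟨h0a, hs2⟩ ⟨h0b, ht2⟩
          (by simpa only [← hsa, ← htb] using hx')
        exact absurd (by rw [hsa, htb, this]) hy'
      · have hua : a ∈ Ico 0 δ := ⟨h0a, hs2⟩
        have hvb : -b ∈ Ico 0 δ := ⟨by linarith, by linarith⟩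
        have := (huv a hua (-b) hvb).1
        simp only [← hsa, ← htb'] at this
        rw [← this ⟨hx', hz'⟩]
        exact Prod.ext hsa htb'
      · have hua : -a ∈ Ico 0 δ := ⟨by linarith, by linarith⟩
        have hvb : b ∈ Ico 0 δ := ⟨h0b, ht2⟩
        have := hq.le b hvb (-a) hua
        simp only [← hsa', ← htb] at this
        have := this hx'.symm
        rw [hz'] at this
        have hε' : (0 : ℝ) < ε := hε
        linarith
      · have : -a = -b := hq.injOn_right ⟨by linarith, by linarith⟩ ⟨by linarith, by linarith⟩
          (by simpa only [← hsa', ← htb'] using hx')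
        exact absurd (by rw [hsa', htb', this]) hy'
    · rintro h
      rw [h]
      refine ⟨⟨hIJ.1, hIJ.2, hsol.1, hsol.2, hyy⟩, ?_, ?_⟩
      · rw [add_sub_cancel_left, habs, abs_of_pos h1.1]
        exact h1.2
      · rw [sub_sub_cancel_left, abs_neg, habs, abs_of_pos h2.1]
        exact h2.2
  · rw [hneg, hder, hder] at hxx'
    have h3 : t₀ - e * (q ε).2 = t₀ + -e * (q ε).2 := by ring
    rw [pairSign, h3, sign_neg]
    · rfl
    · simp only
      linear_combination hxx' - (deriv c (t₀ + e * (q ε).1) 0 * deriv c (t₀ + -e * (q ε).2) 0) * he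

open Classical in
-- Both arcs are parametrized away from the vertex, whereas a cycle enters along one and leaves
-- along the other; hence the minus sign in the weight. On opposite sides the `x` agree only at the
-- vertex itself, where the `y` agree too. On the same side a solution needs the first arc to be the
-- upper one. `I` and `J` may or may not contain `0`, because reversal turns `Ico 0 1` into `Ioc 0
-- 1`.
theorem hasLocalIndex_vertex (h₁ : ContDiff ℝ ∞ c₁) (h₂ : ContDiff ℝ ∞ c₂) (h0 : c₁ 0 = c₂ 0)
    (hI : Ioo 0 1 ⊆ I) (hI' : I ⊆ Ici 0) (hJ : Ioo 0 1 ⊆ J) (hJ' : J ⊆ Ici 0)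
    (t₁ : ∀ t ∈ Ioo (0 : ℝ) 1, TangentAt c₁ t) (t₂ : ∀ t ∈ Ioo (0 : ℝ) 1, TangentAt c₂ t)
    (hx₁ : deriv c₁ 0 0 ≠ 0) (hx₂ : deriv c₂ 0 0 ≠ 0)
    (hm : 0 < deriv c₁ 0 0 * deriv c₂ 0 0 →
      deriv c₁ 0 1 / deriv c₁ 0 0 ≠ deriv c₂ 0 1 / deriv c₂ 0 0) :
    HasLocalIndex (frontPairs c₁ c₂ I J) (fun p => -pairSign c₁ c₂ p) (0, 0)
      (if 0 < deriv c₁ 0 0 * deriv c₂ 0 0 ∧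
        deriv c₂ 0 1 / deriv c₂ 0 0 < deriv c₁ 0 1 / deriv c₁ 0 0 then -1 else 0) := by
  have hU : ∀ δ : ℝ, 0 < δ → {p : ℝ × ℝ | p.1 < δ ∧ p.2 < δ} ∈ 𝓝 ((0 : ℝ), (0 : ℝ)) := by
    intro δ hδ
    refine IsOpen.mem_nhds ?_ ⟨hδ, hδ⟩
    exact (isOpen_lt continuous_fst continuous_const).inter
      (isOpen_lt continuous_snd continuous_const)
  by_cases hside : 0 < deriv c₁ 0 0 * deriv c₂ 0 0
  · rcases lt_or_gt_of_ne (hm hside) with hlt | hgt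
    · rw [if_neg (fun h => lt_asymm h.2 hlt)]
      obtain ⟨q, δ, -, hq⟩ := (wedge_of_slope_lt h₂ h₁ h0.symm t₂ t₁ (by rwa [mul_comm])
        hlt).uniquePair h₂ h₁ h0.symm one_pos
      refine .of_empty (hU δ hq.pos) ?_
      filter_upwards [self_mem_nhdsWithin] with ε hε
      rw [eq_empty_iff_forall_notMem]
      rintro ⟨u, v⟩ ⟨⟨hu, hv, hx, hz, -⟩, hu', hv'⟩
      simp only at hu hv hx hz hu' hv'
      have := hq.le v ⟨hJ' hv, hv'⟩ u ⟨hI' hu, hu'⟩ hx.symm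
      have hε' : (0 : ℝ) < ε := hε
      linarith
    · rw [if_pos ⟨hside, hgt⟩]
      obtain ⟨q, δ, hδ1, hq⟩ := (wedge_of_slope_lt h₁ h₂ h0 t₁ t₂ hside hgt).uniquePair
        h₁ h₂ h0 one_pos
      refine .of_singleton (hU δ hq.pos) hq.tendsto ?_
      filter_upwards [hq.eventually] with ε h
      obtain ⟨h1, h2, hyy, hxx, huv⟩ := h
      have hsol := (huv _ ⟨h1.1.le, h1.2⟩ _ ⟨h2.1.le, h2.2⟩).2 rfl
      refine ⟨?_, ?_⟩
      · ext ⟨u, v⟩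
        rw [mem_singleton_iff]
        constructor
        · rintro ⟨⟨hu, hv, hx, hz, -⟩, hu', hv'⟩
          exact (huv u ⟨hI' hu, hu'⟩ v ⟨hJ' hv, hv'⟩).1 ⟨hx, hz⟩
        · intro h
          rw [h]
          exact ⟨⟨hI ⟨h1.1, h1.2.trans_le hδ1⟩, hJ ⟨h2.1, h2.2.trans_le hδ1⟩, hsol.1, hsol.2, hyy⟩,
            h1.2, h2.2⟩
      · rw [pairSign, sign_pos hxx]
        rfl
  · rw [if_neg (fun h => hside h.1)]
    have hopp : deriv c₁ 0 0 * deriv c₂ 0 0 < 0 :=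
      lt_of_le_of_ne (not_lt.1 hside) (mul_ne_zero hx₁ hx₂)
    have hmono : ∀ {c : ℝ → Space} (σ : ℝ), ContDiff ℝ ∞ c → 0 < σ * deriv c 0 0 →
        ∃ η > 0, ∀ u ∈ Ioc 0 η, 0 < σ * (c u 0 - c 0 0) := by
      intro c σ hc hσ
      refine exists_forall_Ioc_of_eventually ?_
      exact eventually_pos_of_hasDerivAt_pos
        (((hasDerivAt_coord hc 0 0).sub_const _).const_mul σ) (by simp) hσ
    obtain ⟨σ, hσ₁, hσ₂⟩ : ∃ σ : ℝ, 0 < σ * deriv c₁ 0 0 ∧ 0 < -σ * deriv c₂ 0 0 := by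
      rcases mul_neg_iff.1 hopp with h | h
      · exact ⟨1, by simpa using h⟩
      · exact ⟨-1, by simpa using h⟩
    obtain ⟨η₁, hη₁, hu₁⟩ := hmono σ h₁ hσ₁
    obtain ⟨η₂, hη₂, hu₂⟩ := hmono (-σ) h₂ hσ₂
    refine .of_empty (hU (min η₁ η₂) (lt_min hη₁ hη₂)) ?_
    filter_upwards with ε
    rw [eq_empty_iff_forall_notMem]
    rintro ⟨u, v⟩ ⟨⟨hu, hv, hx, -, hy⟩, hu', hv'⟩
    simp only at hu hv hx hy hu' hv'
    have hu0 : 0 ≤ u := hI' hu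
    have hv0 : 0 ≤ v := hJ' hv
    have e1 : 0 < u → 0 < σ * (c₁ u 0 - c₁ 0 0) := fun h =>
      hu₁ u ⟨h, (hu'.trans_le (min_le_left _ _)).le⟩
    have e2 : 0 < v → 0 < -σ * (c₂ v 0 - c₂ 0 0) := fun h =>
      hu₂ v ⟨h, (hv'.trans_le (min_le_right _ _)).le⟩
    rw [hx, h0] at e1
    rcases hu0.eq_or_lt with rfl | hu0 <;> rcases hv0.eq_or_lt with rfl | hv0
    · exact hy (by rw [h0])
    · have := e2 hv0
      rw [← hx, h0] at this
      simp at this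
    · have := e1 hu0
      simp at this
    · linarith [e1 hu0, e2 hv0]

end FrontPairs

/-! ### Crossings of parametrized curves -/

section MutualWrithe

variable {ι κ : Type*} {γ : ι → Space × Space} {η : κ → Space × Space} {S : Set ι} {T : Set κ}

theorem overCrossings_image (hS : InjOn γ S) (hT : InjOn η T) :
    overCrossings (γ '' S) (η '' T) =
      ∑ᶠ p ∈ {p : ι × κ | p.1 ∈ S ∧ p.2 ∈ T ∧ front (γ p.1).1 = front (η p.2).1 ∧
        (γ p.1).1 1 < (η p.2).1 1}, crossingSign (γ p.1, η p.2) := by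
  set P : Set (ι × κ) := {p | p.1 ∈ S ∧ p.2 ∈ T ∧ front (γ p.1).1 = front (η p.2).1 ∧
        (γ p.1).1 1 < (η p.2).1 1} with hP
  have himg : crossings (γ '' S) (η '' T) = (fun p : ι × κ => (γ p.1, η p.2)) '' P := by
    ext c
    constructor
    · obtain ⟨a, b⟩ := c
      rintro ⟨⟨i, hi, rfl⟩, ⟨j, hj, rfl⟩, h1, h2⟩
      exact ⟨(i, j), ⟨hi, hj, h1, h2⟩, rfl⟩
    · rintro ⟨p, ⟨hi, hj, h1, h2⟩, rfl⟩
      exact ⟨mem_image_of_mem _ hi, mem_image_of_mem _ hj, h1, h2⟩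
  rw [overCrossings, himg, finsum_mem_image]
  intro p hp q hq hpq
  exact Prod.ext (hS hp.1 hq.1 (congrArg Prod.fst hpq)) (hT hp.2.1 hq.2.1 (congrArg Prod.snd hpq))

/-- By `dz = y dx` the determinant is `x_a' x_b' (y_b - y_a)`, and the upper strand has the smaller
`y`. -/
theorem crossingSign_eq {a b : Space × Space} (ha : a.2 2 = a.1 1 * a.2 0)
    (hb : b.2 2 = b.1 1 * b.2 0) (hlt : a.1 1 < b.1 1) :
    crossingSign (a, b) = (SignType.sign (a.2 0 * b.2 0) : ℤ) := by
  rw [crossingSign]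
  simp only
  have : a.2 0 * b.2 2 - a.2 2 * b.2 0 = a.2 0 * b.2 0 * (b.1 1 - a.1 1) := by
    rw [ha, hb]; ring
  rw [this, sign_mul, sign_pos (sub_pos.2 hlt), mul_one]

/-- The sign of a Legendrian crossing is symmetric in the two strands, so the crossings of either
kind merge into one sum over pairs with `y₁ ≠ y₂`. -/
theorem mutualWrithe_image (hS : InjOn γ S) (hT : InjOn η T)
    (tS : ∀ i ∈ S, (γ i).2 2 = (γ i).1 1 * (γ i).2 0)
    (tT : ∀ j ∈ T, (η j).2 2 = (η j).1 1 * (η j).2 0)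
    (hfin : {p : ι × κ | p.1 ∈ S ∧ p.2 ∈ T ∧ front (γ p.1).1 = front (η p.2).1 ∧
        (γ p.1).1 1 ≠ (η p.2).1 1}.Finite) :
    mutualWrithe (γ '' S) (η '' T) =
      ∑ᶠ p ∈ {p : ι × κ | p.1 ∈ S ∧ p.2 ∈ T ∧ front (γ p.1).1 = front (η p.2).1 ∧
        (γ p.1).1 1 ≠ (η p.2).1 1},
        (SignType.sign ((γ p.1).2 0 * (η p.2).2 0) : ℤ) := by
  set P : Set (ι × κ) := {p | p.1 ∈ S ∧ p.2 ∈ T ∧ front (γ p.1).1 = front (η p.2).1 ∧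
        (γ p.1).1 1 ≠ (η p.2).1 1} with hP
  set P₁ : Set (ι × κ) := {p | p.1 ∈ S ∧ p.2 ∈ T ∧ front (γ p.1).1 = front (η p.2).1 ∧
        (γ p.1).1 1 < (η p.2).1 1} with hP₁
  set P₂ : Set (ι × κ) := {p | p.1 ∈ S ∧ p.2 ∈ T ∧ front (γ p.1).1 = front (η p.2).1 ∧
        (η p.2).1 1 < (γ p.1).1 1} with hP₂
  have hun : P = P₁ ∪ P₂ := by
    ext p
    simp only [hP, hP₁, hP₂, mem_ofPred_eq, mem_union, ne_iff_lt_or_gt]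
    tauto
  have hdisj : Disjoint P₁ P₂ := by
    rw [Set.disjoint_left]
    rintro p ⟨-, -, -, h1⟩ ⟨-, -, -, h2⟩
    exact lt_asymm h1 h2
  have hswap : {p : κ × ι | p.1 ∈ T ∧ p.2 ∈ S ∧ front (η p.1).1 = front (γ p.2).1 ∧
        (η p.1).1 1 < (γ p.2).1 1} = Prod.swap '' P₂ := by
    ext ⟨j, i⟩
    constructor
    · rintro ⟨h1, h2, h3, h4⟩
      exact ⟨(i, j), ⟨h2, h1, h3.symm, h4⟩, rfl⟩
    · rintro ⟨⟨i', j'⟩, ⟨h1, h2, h3, h4⟩, h⟩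
      obtain ⟨rfl, rfl⟩ := Prod.mk.inj h
      exact ⟨h2, h1, h3.symm, h4⟩
  rw [mutualWrithe, overCrossings_image hS hT, overCrossings_image hT hS, hswap,
    finsum_mem_image Prod.swap_injective.injOn, hun,
    finsum_mem_union hdisj (hfin.subset (hun ▸ subset_union_left))
      (hfin.subset (hun ▸ subset_union_right))]
  congr 1
  · exact finsum_mem_congr rfl fun p hp => crossingSign_eq (tS _ hp.1) (tT _ hp.2.1) hp.2.2.2
  · refine finsum_mem_congr rfl fun p hp => ?_
    rw [mul_comm]
    exact crossingSign_eq (tT _ hp.2.1) (tS _ hp.1) hp.2.2.2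

end MutualWrithe

/-! ### Crossings, cusps and vertices of a Legendrian graph as local contributions -/

namespace LegendrianEmbedding

variable {V : Type*} {G : SimpleGraph V} {F : LegendrianEmbedding G}

theorem tangentAt (F : LegendrianEmbedding G) (d : G.Dart) {t : ℝ} (ht : t ∈ Icc (0 : ℝ) 1) :
    TangentAt (F.edge d) t :=
  sub_eq_zero.1 (F.legendrian d t ht)

theorem edge_symm_eq (F : LegendrianEmbedding G) (d : G.Dart) :
    F.edge d.symm = fun t => F.edge d (1 - t) := funext (F.edge_symm d)

theorem deriv_edge_symm (F : LegendrianEmbedding G) (d : G.Dart) (t : ℝ) :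
    deriv (F.edge d.symm) t = -deriv (F.edge d) (1 - t) := by
  rw [edge_symm_eq, deriv_comp_const_sub]

theorem deriv_edge_symm_coord (F : LegendrianEmbedding G) (d : G.Dart) (t : ℝ) (i : Fin 3) :
    deriv (F.edge d.symm) t i = -deriv (F.edge d) (1 - t) i := by
  rw [deriv_edge_symm]; rfl

theorem edge_injOn (F : LegendrianEmbedding G) (d : G.Dart) : InjOn (F.edge d) (Ioo 0 1) := by
  intro s hs t ht h
  rcases F.edge_injective d d s hs t ht h with h | h
  · exact h.2.symm
  · exact absurd h.1.symm d.symm_ne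

theorem space_ext {p q : Space} (hf : front p = front q) (hy : p 1 = q 1) : p = q := by
  ext i
  fin_cases i
  · exact congrArg Prod.fst hf
  · exact hy
  · exact congrArg Prod.snd hf

/-- The pairs of parameters at which two open edges cross in the front. -/
def crossPairs (F : LegendrianEmbedding G) (d d' : G.Dart) : Set (ℝ × ℝ) :=
  frontPairs (F.edge d) (F.edge d') (Ioo 0 1) (Ioo 0 1) 0

theorem crossPairs_eq (F : LegendrianEmbedding G) (d d' : G.Dart) : F.crossPairs d d' =
    {p : ℝ × ℝ | p.1 ∈ Ioo (0 : ℝ) 1 ∧ p.2 ∈ Ioo (0 : ℝ) 1 ∧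
      front (F.edge d p.1) = front (F.edge d' p.2) ∧ F.edge d p.1 1 ≠ F.edge d' p.2 1} := by
  ext p
  simp only [crossPairs, frontPairs, front, mem_ofPred_eq, add_zero, Prod.mk.injEq]
  tauto

theorem edge_point_injOn (F : LegendrianEmbedding G) (d : G.Dart) :
    InjOn (fun t => (F.edge d t, deriv (F.edge d) t)) (Ioo 0 1) :=
  fun _ hs _ ht h => F.edge_injOn d hs ht (congrArg Prod.fst h)

theorem HasGenericFront.finite_crossPairs (hF : F.HasGenericFront) (d d' : G.Dart) :
    (F.crossPairs d d').Finite := by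
  let γ : G.Dart → ℝ → Space × Space := fun d t => (F.edge d t, deriv (F.edge d) t)
  have h1 : (F.crossPairs d d' ∩ {p | F.edge d p.1 1 < F.edge d' p.2 1}).Finite := by
    refine Set.Finite.of_finite_image (f := fun p => (γ d p.1, γ d' p.2))
      ((hF.finite_crossings d d').subset ?_) ?_
    · rintro _ ⟨p, ⟨hp, hlt⟩, rfl⟩
      rw [crossPairs_eq] at hp
      exact ⟨⟨p.1, hp.1, rfl⟩, ⟨p.2, hp.2.1, rfl⟩, hp.2.2.1, hlt⟩
    · intro p hp q hq h
      exact Prod.ext (F.edge_point_injOn d hp.1.1 hq.1.1 (congrArg Prod.fst h))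
        (F.edge_point_injOn d' hp.1.2.1 hq.1.2.1 (congrArg Prod.snd h))
  have h2 : (F.crossPairs d d' ∩ {p | F.edge d' p.2 1 < F.edge d p.1 1}).Finite := by
    refine Set.Finite.of_finite_image (f := fun p => (γ d' p.2, γ d p.1))
      ((hF.finite_crossings d' d).subset ?_) ?_
    · rintro _ ⟨p, ⟨hp, hlt⟩, rfl⟩
      rw [crossPairs_eq] at hp
      exact ⟨⟨p.2, hp.2.1, rfl⟩, ⟨p.1, hp.1, rfl⟩, hp.2.2.1.symm, hlt⟩
    · intro p hp q hq h
      exact Prod.ext (F.edge_point_injOn d hp.1.1 hq.1.1 (congrArg Prod.snd h))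
        (F.edge_point_injOn d' hp.1.2.1 hq.1.2.1 (congrArg Prod.fst h))
  refine (h1.union h2).subset fun p hp => ?_
  rcases lt_or_gt_of_ne hp.2.2.2.2 with h | h
  · exact Or.inl ⟨hp, h⟩
  · exact Or.inr ⟨hp, h⟩

theorem HasGenericFront.mutualWrithe_openEdge (hF : F.HasGenericFront) (d d' : G.Dart) :
    mutualWrithe (F.openEdge d) (F.openEdge d') =
      ∑ᶠ p ∈ F.crossPairs d d', pairSign (F.edge d) (F.edge d') p := by
  have hfin := hF.finite_crossPairs d d'
  rw [crossPairs_eq] at hfin ⊢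
  exact mutualWrithe_image (F.edge_point_injOn d) (F.edge_point_injOn d')
    (fun t ht => F.tangentAt d (Ioo_subset_Icc_self ht))
    (fun t ht => F.tangentAt d' (Ioo_subset_Icc_self ht)) hfin

theorem HasGenericFront.hasLocalIndex_crossPairs (hF : F.HasGenericFront) {d d' : G.Dart}
    {p : ℝ × ℝ} (hp : p ∈ F.crossPairs d d') :
    HasLocalIndex (frontPairs (F.edge d) (F.edge d') (Ico 0 1) (Ico 0 1))
      (pairSign (F.edge d) (F.edge d')) p (pairSign (F.edge d) (F.edge d') p) := by
  have hp' := hp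
  rw [crossPairs_eq] at hp'
  obtain ⟨hs, ht, hf, hy⟩ := hp'
  obtain ⟨x1, x2⟩ := hF.smooth_at_crossing d d' _ hs _ ht hf fun h => hy (by rw [h])
  exact hasLocalIndex_crossing (F.contDiff d) (F.contDiff d') (Ico_mem_nhds hs.1 hs.2)
    (Ico_mem_nhds ht.1 ht.2)
    ⟨Ioo_subset_Ico_self hs, Ioo_subset_Ico_self ht, hp.2.2⟩
    (F.tangentAt d (Ioo_subset_Icc_self hs)) (F.tangentAt d' (Ioo_subset_Icc_self ht)) x1 x2

theorem HasGenericFront.smooth_at_one (hF : F.HasGenericFront) (d : G.Dart) :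
    deriv (F.edge d) 1 0 ≠ 0 := by
  have := hF.smooth_at_vertex d.symm
  rw [deriv_edge_symm_coord, sub_zero] at this
  exact neg_ne_zero.1 this

/-- Zeros of `x'` are isolated because `x'' ≠ 0` there, and the end points are no zeros; `[0, 1]` is
compact. Finiteness matters because `ncard` of an infinite set is `0`. -/
theorem HasGenericFront.finite_cusps (hF : F.HasGenericFront) (d : G.Dart) :
    {t ∈ Ioo (0 : ℝ) 1 | deriv (F.edge d) t 0 = 0}.Finite := by
  by_contra hinf
  obtain ⟨z, hz, hacc⟩ := Set.Infinite.exists_accPt_of_subset_isCompact hinf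
    (isCompact_Icc (a := (0 : ℝ)) (b := 1)) (fun t ht => Ioo_subset_Icc_self ht.1)
  have hcont : Continuous fun t => deriv (F.edge d) t 0 :=
    (contDiff_coord (contDiff_deriv (F.contDiff d)) 0).continuous
  have hne : ∀ᶠ t in 𝓝[≠] z, deriv (F.edge d) t 0 ≠ 0 := by
    by_cases h0 : deriv (F.edge d) z 0 = 0
    · have hzI : z ∈ Ioo (0 : ℝ) 1 := by
        refine ⟨lt_of_le_of_ne hz.1 ?_, lt_of_le_of_ne hz.2 ?_⟩
        · rintro rfl
          exact hF.smooth_at_vertex d h0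
        · rintro rfl
          exact hF.smooth_at_one d h0
      exact (hasDerivAt_coord (contDiff_deriv (F.contDiff d)) 0 z).eventually_ne
        (hF.semicubical d z hzI h0)
    · exact nhdsWithin_le_nhds (hcont.continuousAt.eventually_ne h0)
  obtain ⟨t, h1, h2⟩ := ((accPt_iff_frequently_nhdsNE.1 hacc).and_eventually hne).exists
  exact h2 h1.2

theorem HasGenericFront.hasLocalIndex_cusp (hF : F.HasGenericFront) {d : G.Dart} {t : ℝ}
    (ht : t ∈ Ioo (0 : ℝ) 1) (hx : deriv (F.edge d) t 0 = 0) :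
    HasLocalIndex (frontPairs (F.edge d) (F.edge d) (Ico 0 1) (Ico 0 1))
      (pairSign (F.edge d) (F.edge d)) (t, t) (-1) := by
  refine LegendrianGraph.hasLocalIndex_cusp (F.contDiff d) (Ico_mem_nhds ht.1 ht.2)
    (Ico_mem_nhds ht.1 ht.2) ?_ hx (hF.semicubical d t ht hx) fun hy => ?_
  · filter_upwards [Ioo_mem_nhds ht.1 ht.2] with s hs using F.tangentAt d (Ioo_subset_Icc_self hs)
  -- At a cusp `x' = 0` and `z' = y x' = 0`, so an immersed arc has `y' ≠ 0`.
  · refine F.immersed d t (Ioo_subset_Icc_self ht) ?_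
    have hz := F.tangentAt d (Ioo_subset_Icc_self ht)
    rw [TangentAt, hx, mul_zero] at hz
    ext i
    fin_cases i
    · exact hx
    · exact hy
    · exact hz

theorem mem_Ioo_or_of_mem_Icc {t : ℝ} (ht : t ∈ Icc (0 : ℝ) 1) :
    t ∈ Ioo (0 : ℝ) 1 ∨ t = 0 ∨ t = 1 := by
  rcases ht.1.eq_or_lt with h | h
  · exact Or.inr (Or.inl h.symm)
  · rcases ht.2.eq_or_lt with h' | h'
    · exact Or.inr (Or.inr h')
    · exact Or.inl ⟨h, h'⟩

/-- Points of two edges with the same front are both interior or both vertices. -/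
theorem HasGenericFront.interior_iff (hF : F.HasGenericFront) {d d' : G.Dart} {s t : ℝ}
    (ht : t ∈ Icc (0 : ℝ) 1) (hs : s ∈ Ioo (0 : ℝ) 1)
    (h : front (F.edge d s) = front (F.edge d' t)) : t ∈ Ioo (0 : ℝ) 1 := by
  rcases mem_Ioo_or_of_mem_Icc ht with h' | rfl | rfl
  · exact h'
  · rw [F.edge_zero] at h
    exact absurd h (hF.front_edge_ne_vertex d s hs _)
  · rw [F.edge_one] at h
    exact absurd h (hF.front_edge_ne_vertex d s hs _)

theorem frontPairs_subset {c₁ c₂ : ℝ → Space} (ε : ℝ) :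
    frontPairs c₁ c₂ (Ico 0 1) (Ico 0 1) ε ⊆ Icc (0 : ℝ) 1 ×ˢ Icc (0 : ℝ) 1 :=
  fun _ hp => ⟨Ico_subset_Icc_self hp.1, Ico_subset_Icc_self hp.2.1⟩

open Classical in
-- Limit positions are the self-crossings, each in both orders (hence `mutualWrithe`, twice the
-- writhe), and the diagonal pairs at cusps, each of index `-1`.
theorem HasGenericFront.eventually_finsum_self (hF : F.HasGenericFront) (d : G.Dart) :
    ∀ᶠ ε in 𝓝[>] (0 : ℝ),
      (frontPairs (F.edge d) (F.edge d) (Ico 0 1) (Ico 0 1) ε).Finite ∧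
      ∑ᶠ p ∈ frontPairs (F.edge d) (F.edge d) (Ico 0 1) (Ico 0 1) ε,
        pairSign (F.edge d) (F.edge d) p =
      mutualWrithe (F.openEdge d) (F.openEdge d) - F.cuspsAlongEdge d := by
  have hfin := hF.finite_crossPairs d d
  have hcusp := hF.finite_cusps d
  set C := hfin.toFinset with hC
  set Z := hcusp.toFinset.image fun t => (t, t) with hZ
  have hdisj : Disjoint C Z := by
    rw [Finset.disjoint_left]
    intro p hp hpZ
    obtain ⟨t, -, rfl⟩ := Finset.mem_image.1 hpZ
    exact (hfin.mem_toFinset.1 hp).2.2.2.2 rfl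
  have key := eventually_finsum_eq_sum_localIndex
    (w := pairSign (F.edge d) (F.edge d))
    (k := fun p => if p ∈ C then pairSign (F.edge d) (F.edge d) p else -1)
    (isCompact_Icc.prod isCompact_Icc)
    (frontPairs_subset (c₁ := F.edge d) (c₂ := F.edge d)) (C ∪ Z) ?_ ?_
  · filter_upwards [key] with ε hε
    refine ⟨hε.1, hε.2.trans ?_⟩
    rw [Finset.sum_union hdisj, hF.mutualWrithe_openEdge, sub_eq_add_neg,
      finsum_mem_eq_finite_toFinset_sum _ hfin]
    congr 1
    · exact Finset.sum_congr rfl fun p hp => if_pos hp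
    · rw [Finset.sum_congr rfl fun p hp => if_neg (Finset.disjoint_right.1 hdisj hp),
        Finset.sum_const, hZ, Finset.card_image_of_injective _ fun a b h => congrArg Prod.fst h,
        cuspsAlongEdge, Set.ncard_eq_toFinset_card _ hcusp]
      simp
  · intro p hp
    by_cases h : p ∈ C
    · simp only [if_pos h]
      exact hF.hasLocalIndex_crossPairs (hfin.mem_toFinset.1 h)
    · simp only [if_neg h]
      obtain ⟨t, ht, rfl⟩ := Finset.mem_image.1 ((Finset.mem_union.1 hp).resolve_left h)
      have ht' := hcusp.mem_toFinset.1 ht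
      exact hF.hasLocalIndex_cusp ht'.1 ht'.2
  · rintro ⟨s, t⟩ ⟨hs, ht⟩ hS
    by_cases hf : front (F.edge d s) = front (F.edge d t)
    · have hst : t = s ∧ deriv (F.edge d) s 0 ≠ 0 := by
        rcases mem_Ioo_or_of_mem_Icc hs with hs' | hs'
        · have ht' := hF.interior_iff ht hs' hf
          have hts : t = s := by
            by_contra hts
            refine hS (Finset.mem_union_left _ (hfin.mem_toFinset.2 ?_))
            rw [crossPairs_eq]
            exact ⟨hs', ht', hf, fun hy => hts (F.edge_injOn d ht' hs' (space_ext hf hy).symm)⟩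
          subst hts
          refine ⟨rfl, fun hx => hS (Finset.mem_union_right _ ?_)⟩
          exact Finset.mem_image.2 ⟨t, hcusp.mem_toFinset.2 ⟨hs', hx⟩, rfl⟩
        · rcases mem_Ioo_or_of_mem_Icc ht with ht' | ht'
          · have := hF.interior_iff hs ht' hf.symm
            rcases hs' with rfl | rfl <;> simp at this
          · have hne := d.fst_ne_snd
            rcases hs' with rfl | rfl <;> rcases ht' with rfl | rfl <;>
              simp only [F.edge_zero, F.edge_one] at hf
            · exact ⟨rfl, hF.smooth_at_vertex d⟩
            · exact absurd (hF.front_vertex_injective hf) hne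
            · exact absurd (hF.front_vertex_injective hf) hne.symm
            · exact ⟨rfl, hF.smooth_at_one d⟩
      obtain ⟨rfl, hx⟩ := hst
      exact exists_nhds_frontPairs_eq_empty_of_regular (F.contDiff d) hx
    · exact exists_nhds_frontPairs_eq_empty_of_ne (F.contDiff d) (F.contDiff d) hf

open Classical in
/-- `-1` if the edges leave a common vertex to the same side, the first above the second. -/
noncomputable def vertexIndex (F : LegendrianEmbedding G) (a b : G.Dart) : ℤ :=
  if a.fst = b.fst ∧ 0 < deriv (F.edge a) 0 0 * deriv (F.edge b) 0 0 ∧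
    deriv (F.edge b) 0 1 / deriv (F.edge b) 0 0 < deriv (F.edge a) 0 1 / deriv (F.edge a) 0 0
  then -1 else 0

/-- At a common vertex `z' = y x'` with the same `y`, so equal `dy/dx` and equal signs of `x'` would
make the velocities positive multiples of each other. -/
theorem HasGenericFront.slope_ne (hF : F.HasGenericFront) {a b : G.Dart} (h : a.fst = b.fst)
    (hab : a ≠ b) (hx : 0 < deriv (F.edge a) 0 0 * deriv (F.edge b) 0 0) :
    deriv (F.edge a) 0 1 / deriv (F.edge a) 0 0 ≠
      deriv (F.edge b) 0 1 / deriv (F.edge b) 0 0 := by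
  intro hm
  refine F.not_tangent a b h hab ?_
  have h0 : (0 : ℝ) ∈ Icc (0 : ℝ) 1 := ⟨le_rfl, zero_le_one⟩
  have xa := hF.smooth_at_vertex a
  have xb := hF.smooth_at_vertex b
  have za := F.tangentAt a h0
  have zb := F.tangentAt b h0
  rw [TangentAt, F.edge_zero] at za zb
  rw [← h] at zb
  have hr : 0 < deriv (F.edge b) 0 0 / deriv (F.edge a) 0 0 := by
    rcases mul_pos_iff.1 hx with h | h
    · exact div_pos h.2 h.1
    · exact div_pos_of_neg_of_neg h.2 h.1
  have : deriv (F.edge b) 0 =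
      (deriv (F.edge b) 0 0 / deriv (F.edge a) 0 0) • deriv (F.edge a) 0 := by
    rw [div_eq_div_iff xa xb] at hm
    ext i
    rw [PiLp.smul_apply, smul_eq_mul, div_mul_eq_mul_div, eq_div_iff xa]
    fin_cases i
    · rfl
    · simp only [Fin.mk_one]
      linarith
    · simp only [Fin.reduceFinMk]
      rw [za, zb]
      ring
  rw [this]
  exact SameRay.sameRay_pos_smul_right _ hr

theorem HasGenericFront.hasLocalIndex_vertex (hF : F.HasGenericFront) {a b : G.Dart}
    (h : a.fst = b.fst) (hab : a ≠ b) {I J : Set ℝ}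
    (hI : Ioo 0 1 ⊆ I) (hI' : I ⊆ Ici 0) (hJ : Ioo 0 1 ⊆ J) (hJ' : J ⊆ Ici 0) :
    HasLocalIndex (frontPairs (F.edge a) (F.edge b) I J)
      (fun p => -pairSign (F.edge a) (F.edge b) p) (0, 0) (F.vertexIndex a b) := by
  have := LegendrianGraph.hasLocalIndex_vertex (F.contDiff a) (F.contDiff b)
    (by rw [F.edge_zero, F.edge_zero, h]) hI hI' hJ hJ'
    (fun t ht => F.tangentAt a (Ioo_subset_Icc_self ht))
    (fun t ht => F.tangentAt b (Ioo_subset_Icc_self ht)) (hF.smooth_at_vertex a)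
    (hF.smooth_at_vertex b) (hF.slope_ne h hab)
  simpa only [vertexIndex, h, true_and] using this

/-- Head of `d` against tail of `d'`. Replacing `d` by its reversal gives two arcs issuing from the
vertex; the sign change of the velocity cancels the minus sign in the local count there. If the two
vertices differ, both the count and `vertexIndex` are `0`. -/
theorem HasGenericFront.hasLocalIndex_one_zero (hF : F.HasGenericFront) {d d' : G.Dart}
    (hsymm : d' ≠ d.symm) :
    HasLocalIndex (frontPairs (F.edge d) (F.edge d') (Ico 0 1) (Ico 0 1))
      (pairSign (F.edge d) (F.edge d')) (1, 0) (F.vertexIndex d.symm d') := by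
  by_cases h : d.snd = d'.fst
  · have := (hF.hasLocalIndex_vertex (a := d.symm) (b := d') h hsymm.symm (I := Ioc 0 1)
      (J := Ico 0 1) Ioo_subset_Ioc_self (fun t ht => ht.1.le) Ioo_subset_Ico_self
      (fun t ht => ht.1)).homeomorph
      (Sol' := frontPairs (F.edge d) (F.edge d') (Ico 0 1) (Ico 0 1))
      (w' := pairSign (F.edge d) (F.edge d'))
      ((Homeomorph.subLeft (1 : ℝ)).prodCongr (Homeomorph.refl ℝ)) ?_ ?_
    · simpa using this
    · rintro ε ⟨u, v⟩
      have : (1 - u ∈ Ico (0 : ℝ) 1) ↔ u ∈ Ioc (0 : ℝ) 1 := by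
        simp only [mem_Ico, mem_Ioc]
        constructor <;> rintro ⟨h1, h2⟩ <;> constructor <;> linarith
      simp [frontPairs, edge_symm_eq, -mem_Ico, -mem_Ioc, this]
    · rintro ⟨u, v⟩
      simp only [pairSign, deriv_edge_symm_coord, neg_mul, Left.sign_neg, SignType.coe_neg, neg_neg]
      rfl
  · have hne : front (F.edge d 1) ≠ front (F.edge d' 0) := by
      rw [F.edge_one, F.edge_zero]
      exact fun hf => h (hF.front_vertex_injective hf)
    obtain ⟨U, hU, hU'⟩ := exists_nhds_frontPairs_eq_empty_of_ne (F.contDiff d) (F.contDiff d') hne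
    rw [vertexIndex, if_neg fun h' => h h'.1]
    exact .of_empty hU hU'

theorem HasGenericFront.hasLocalIndex_zero_one (hF : F.HasGenericFront) {d d' : G.Dart}
    (hsymm : d' ≠ d.symm) :
    HasLocalIndex (frontPairs (F.edge d) (F.edge d') (Ico 0 1) (Ico 0 1))
      (pairSign (F.edge d) (F.edge d')) (0, 1) (F.vertexIndex d d'.symm) := by
  by_cases h : d.fst = d'.snd
  · have := (hF.hasLocalIndex_vertex (a := d) (b := d'.symm) h
      (fun h => hsymm (by rw [h, SimpleGraph.Dart.symm_symm])) (I := Ico 0 1)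
      (J := Ioc 0 1) Ioo_subset_Ico_self (fun t ht => ht.1) Ioo_subset_Ioc_self
      (fun t ht => ht.1.le)).homeomorph
      (Sol' := frontPairs (F.edge d) (F.edge d') (Ico 0 1) (Ico 0 1))
      (w' := pairSign (F.edge d) (F.edge d'))
      ((Homeomorph.refl ℝ).prodCongr (Homeomorph.subLeft (1 : ℝ))) ?_ ?_
    · simpa using this
    · rintro ε ⟨u, v⟩
      have : (1 - v ∈ Ico (0 : ℝ) 1) ↔ v ∈ Ioc (0 : ℝ) 1 := by
        simp only [mem_Ico, mem_Ioc]
        constructor <;> rintro ⟨h1, h2⟩ <;> constructor <;> linarith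
      simp [frontPairs, edge_symm_eq, -mem_Ico, -mem_Ioc, this]
    · rintro ⟨u, v⟩
      simp only [pairSign, deriv_edge_symm_coord, mul_neg, Left.sign_neg, SignType.coe_neg, neg_neg]
      rfl
  · have hne : front (F.edge d 0) ≠ front (F.edge d' 1) := by
      rw [F.edge_one, F.edge_zero]
      exact fun hf => h (hF.front_vertex_injective hf)
    obtain ⟨U, hU, hU'⟩ := exists_nhds_frontPairs_eq_empty_of_ne (F.contDiff d) (F.contDiff d') hne
    rw [vertexIndex, if_neg fun h' => h h'.1]
    exact .of_empty hU hU'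

open Classical in
-- Different darts of an oriented cycle can meet only head to tail, so beside the crossings the only
-- possible limit positions are `(1, 0)` and `(0, 1)`.
theorem HasGenericFront.eventually_finsum_of_ne (hF : F.HasGenericFront) {d d' : G.Dart}
    (hfst : d.fst ≠ d'.fst) (hsnd : d.snd ≠ d'.snd) (hsymm : d' ≠ d.symm) :
    ∀ᶠ ε in 𝓝[>] (0 : ℝ),
      (frontPairs (F.edge d) (F.edge d') (Ico 0 1) (Ico 0 1) ε).Finite ∧
      ∑ᶠ p ∈ frontPairs (F.edge d) (F.edge d') (Ico 0 1) (Ico 0 1) ε,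
        pairSign (F.edge d) (F.edge d') p =
      mutualWrithe (F.openEdge d) (F.openEdge d') +
        (F.vertexIndex d.symm d' + F.vertexIndex d d'.symm) := by
  have hfin := hF.finite_crossPairs d d'
  set C := hfin.toFinset with hC
  have h10 : ((1 : ℝ), (0 : ℝ)) ∉ C := fun h => (hfin.mem_toFinset.1 h).1.2.ne rfl
  have h01 : ((0 : ℝ), (1 : ℝ)) ∉ C := fun h => (hfin.mem_toFinset.1 h).1.1.ne rfl
  have hne : ((1 : ℝ), (0 : ℝ)) ≠ (0, 1) := by simp
  set k : ℝ × ℝ → ℤ := fun p => if p ∈ C then pairSign (F.edge d) (F.edge d') p else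
    if p = (1, 0) then F.vertexIndex d.symm d' else F.vertexIndex d d'.symm with hk
  have k10 : k (1, 0) = F.vertexIndex d.symm d' := by simp [hk, h10]
  have k01 : k (0, 1) = F.vertexIndex d d'.symm := by simp [hk, h01]
  have key := eventually_finsum_eq_sum_localIndex
    (w := pairSign (F.edge d) (F.edge d')) (k := k) (isCompact_Icc.prod isCompact_Icc)
    (frontPairs_subset (c₁ := F.edge d) (c₂ := F.edge d')) (C ∪ {(1, 0), (0, 1)}) ?_ ?_
  · filter_upwards [key] with ε hε
    refine ⟨hε.1, hε.2.trans ?_⟩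
    rw [Finset.sum_union (by simp [h10, h01]), Finset.sum_pair hne, k10, k01,
      hF.mutualWrithe_openEdge, finsum_mem_eq_finite_toFinset_sum _ hfin]
    congr 1
    exact Finset.sum_congr rfl fun p hp => if_pos hp
  · intro p hp
    rw [Finset.mem_union, Finset.mem_insert, Finset.mem_singleton] at hp
    rcases hp with h | rfl | rfl
    · simp only [hk, if_pos h]
      exact hF.hasLocalIndex_crossPairs (hfin.mem_toFinset.1 h)
    · rw [k10]
      exact hF.hasLocalIndex_one_zero hsymm
    · rw [k01]
      exact hF.hasLocalIndex_zero_one hsymm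
  · rintro ⟨s, t⟩ ⟨hs, ht⟩ hS
    refine exists_nhds_frontPairs_eq_empty_of_ne (F.contDiff d) (F.contDiff d') fun hf => ?_
    rcases mem_Ioo_or_of_mem_Icc hs with hs' | hs'
    · have ht' := hF.interior_iff ht hs' hf
      refine hS (Finset.mem_union_left _ (hfin.mem_toFinset.2 ?_))
      rw [crossPairs_eq]
      refine ⟨hs', ht', hf, fun hy => ?_⟩
      rcases F.edge_injective d d' s hs' t ht' (space_ext hf hy) with h | h
      · exact hfst (by rw [h.1])
      · exact hsymm h.1
    · rcases mem_Ioo_or_of_mem_Icc ht with ht' | ht'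
      · have := hF.interior_iff hs ht' hf.symm
        rcases hs' with rfl | rfl <;> simp at this
      · rcases hs' with rfl | rfl <;> rcases ht' with rfl | rfl <;>
          simp only [F.edge_zero, F.edge_one] at hf
        · exact hfst (hF.front_vertex_injective hf)
        · simp at hS
        · simp at hS
        · exact hsnd (hF.front_vertex_injective hf)

end LegendrianEmbedding

namespace LegendrianEmbedding

variable {V : Type*} {G : SimpleGraph V} {F : LegendrianEmbedding G}

/-! ### The linking number of a cycle with its push-off -/

/-- The two edges leave a common vertex to the same side in the front. -/
def SameSide (F : LegendrianEmbedding G) (a b : G.Dart) : Prop :=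
  a.fst = b.fst ∧ 0 < deriv (F.edge a) 0 0 * deriv (F.edge b) 0 0

theorem sameSide_comm (F : LegendrianEmbedding G) (a b : G.Dart) :
    F.SameSide a b ↔ F.SameSide b a := by
  rw [SameSide, SameSide, mul_comm, eq_comm]

open Classical in
-- Two edges on the same side have different `dy/dx`, so exactly one of the two orders has the upper
-- edge first.
theorem HasGenericFront.vertexIndex_add (hF : F.HasGenericFront) {a b : G.Dart} (hab : a ≠ b) :
    F.vertexIndex a b + F.vertexIndex b a = -(if F.SameSide a b then 1 else 0) := by
  by_cases h : F.SameSide a b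
  · have hba := (F.sameSide_comm a b).1 h
    rw [if_pos h, vertexIndex, vertexIndex]
    rcases lt_or_gt_of_ne (hF.slope_ne h.1 hab h.2) with hlt | hlt
    · rw [if_neg fun h' => lt_asymm h'.2.2 hlt, if_pos ⟨hba.1, hba.2, hlt⟩]
      rfl
    · rw [if_pos ⟨h.1, h.2, hlt⟩, if_neg fun h' => lt_asymm h'.2.2 hlt]
      rfl
  · rw [if_neg h, vertexIndex, vertexIndex, if_neg fun h' => h ⟨h'.1, h'.2.1⟩,
      if_neg fun h' => h ((F.sameSide_comm a b).2 ⟨h'.1, h'.2.1⟩)]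
    rfl

/-- A set of darts such that every vertex is left and entered at most once, without
backtracking. -/
structure IsCyclic (D : Finset G.Dart) : Prop where
  fst_inj : ∀ d ∈ D, ∀ d' ∈ D, d.fst = d'.fst → d = d'
  snd_inj : ∀ d ∈ D, ∀ d' ∈ D, d.snd = d'.snd → d = d'
  symm_notMem : ∀ d ∈ D, d.symm ∉ D

open Classical in
/-- Twice the Thurston-Bennequin number of a set of darts, in terms of crossings and cusps. -/
noncomputable def twiceTB (F : LegendrianEmbedding G) (D : Finset G.Dart) : ℤ :=
  ∑ d ∈ D, ∑ d' ∈ D, mutualWrithe (F.openEdge d) (F.openEdge d')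
    - ∑ d ∈ D, (F.cuspsAlongEdge d : ℤ)
    - ∑ d ∈ D, ∑ d' ∈ D, if F.SameSide d.symm d' then 1 else 0

open Classical in
theorem HasGenericFront.eventually_finsum (hF : F.HasGenericFront) {D : Finset G.Dart}
    (hD : IsCyclic D) :
    ∀ᶠ ε in 𝓝[>] (0 : ℝ), ∀ x ∈ D ×ˢ D,
      (frontPairs (F.edge x.1) (F.edge x.2) (Ico 0 1) (Ico 0 1) ε).Finite ∧
      ∑ᶠ p ∈ frontPairs (F.edge x.1) (F.edge x.2) (Ico 0 1) (Ico 0 1) ε,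
        pairSign (F.edge x.1) (F.edge x.2) p =
      mutualWrithe (F.openEdge x.1) (F.openEdge x.2)
        - (if x.1 = x.2 then (F.cuspsAlongEdge x.1 : ℤ) else 0)
        + (F.vertexIndex x.1.symm x.2 + F.vertexIndex x.1 x.2.symm) := by
  rw [Filter.eventually_all_finset]
  rintro ⟨d, d'⟩ hx
  obtain ⟨hd, hd'⟩ := Finset.mem_product.1 hx
  simp only at hd hd' ⊢
  by_cases h : d = d'
  · subst h
    rw [if_pos rfl, vertexIndex, vertexIndex, if_neg fun h => d.fst_ne_snd h.1.symm,
      if_neg fun h => d.fst_ne_snd h.1, add_zero, add_zero]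
    exact hF.eventually_finsum_self d
  · rw [if_neg h, sub_zero]
    exact hF.eventually_finsum_of_ne (fun h' => h (hD.fst_inj d hd d' hd' h'))
      (fun h' => h (hD.snd_inj d hd d' hd' h')) fun h' => hD.symm_notMem d hd (h' ▸ hd')

open Classical in
theorem HasGenericFront.sum_eq_twiceTB (hF : F.HasGenericFront) {D : Finset G.Dart}
    (hD : IsCyclic D) :
    ∑ x ∈ D ×ˢ D, (mutualWrithe (F.openEdge x.1) (F.openEdge x.2)
        - (if x.1 = x.2 then (F.cuspsAlongEdge x.1 : ℤ) else 0)
        + (F.vertexIndex x.1.symm x.2 + F.vertexIndex x.1 x.2.symm)) = F.twiceTB D := by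
  -- Exchanging the summation variables brings the tail-to-head terms to the vertices of the
  -- head-to-tail terms, so that the two orders at each vertex can be added.
  have h1 : ∑ d ∈ D, ∑ d' ∈ D, F.vertexIndex d d'.symm =
      ∑ d ∈ D, ∑ d' ∈ D, F.vertexIndex d' d.symm := Finset.sum_comm
  have h2 : ∑ d ∈ D, ∑ d' ∈ D, F.vertexIndex d.symm d' + ∑ d ∈ D, ∑ d' ∈ D, F.vertexIndex d' d.symm
      = -∑ d ∈ D, ∑ d' ∈ D, if F.SameSide d.symm d' then 1 else 0 := by
    rw [← Finset.sum_add_distrib, ← Finset.sum_neg_distrib]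
    refine Finset.sum_congr rfl fun d hd => ?_
    rw [← Finset.sum_add_distrib, ← Finset.sum_neg_distrib]
    refine Finset.sum_congr rfl fun d' hd' => hF.vertexIndex_add ?_
    rintro rfl
    exact hD.symm_notMem d hd hd'
  have h3 : ∑ d ∈ D, ∑ d' ∈ D, (if d = d' then (F.cuspsAlongEdge d : ℤ) else 0) =
      ∑ d ∈ D, (F.cuspsAlongEdge d : ℤ) := by
    refine Finset.sum_congr rfl fun d hd => ?_
    rw [Finset.sum_ite_eq, if_pos hd]
  rw [Finset.sum_product]
  simp only [Finset.sum_add_distrib, Finset.sum_sub_distrib]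
  rw [h1, h2, h3, twiceTB]
  ring

/-- The point and the velocity of the edge `p.1` at time `p.2`. -/
noncomputable def point (F : LegendrianEmbedding G) (p : G.Dart × ℝ) : Space × Space :=
  (F.edge p.1 p.2, deriv (F.edge p.1) p.2)

/-- The half-open intervals list every vertex once, at the dart leaving it. Injectivity lets
crossings, defined on sets of points, be counted by parameters. -/
theorem point_injOn (F : LegendrianEmbedding G) {D : Finset G.Dart} (hD : IsCyclic D) :
    InjOn F.point {p | p.1 ∈ D ∧ p.2 ∈ Ico (0 : ℝ) 1} := by
  rintro ⟨d, s⟩ ⟨hd, hs⟩ ⟨d', t⟩ ⟨hd', ht⟩ h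
  replace h : F.edge d s = F.edge d' t := congrArg Prod.fst h
  simp only at hd hs hd' ht
  rcases hs.1.eq_or_lt with rfl | hs0 <;> rcases ht.1.eq_or_lt with rfl | ht0
  · rw [F.edge_zero, F.edge_zero] at h
    rw [hD.fst_inj d hd d' hd' (F.vertex_injective h)]
  · rw [F.edge_zero] at h
    exact absurd h.symm (F.edge_ne_vertex d' t ⟨ht0, ht.2⟩ _)
  · rw [F.edge_zero] at h
    exact absurd h (F.edge_ne_vertex d s ⟨hs0, hs.2⟩ _)
  · rcases F.edge_injective d d' s ⟨hs0, hs.2⟩ t ⟨ht0, ht.2⟩ h with ⟨rfl, rfl⟩ | ⟨rfl, -⟩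
    · rfl
    · exact absurd hd' (hD.symm_notMem d hd)

theorem loop_eq_image (F : LegendrianEmbedding G) {v : V} (c : G.Walk v v) {D : Finset G.Dart}
    (hc : ∀ d, d ∈ c.darts ↔ d ∈ D) :
    F.loop c = F.point '' {p | p.1 ∈ D ∧ p.2 ∈ Ico (0 : ℝ) 1} := by
  ext a
  simp only [loop, mem_iUnion, exists_prop, hc]
  constructor
  · rintro ⟨d, hd, t, ht, rfl⟩
    exact ⟨(d, t), ⟨hd, ht⟩, rfl⟩
  · rintro ⟨⟨d, t⟩, ⟨hd, ht⟩, rfl⟩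
    exact ⟨d, hd, t, ht, rfl⟩

theorem HasGenericFront.eventually_linkingNumber (hF : F.HasGenericFront) {v : V} (c : G.Walk v v)
    {D : Finset G.Dart} (hD : IsCyclic D) (hc : ∀ d, d ∈ c.darts ↔ d ∈ D) :
    ∀ᶠ ε in 𝓝[>] (0 : ℝ),
      linkingNumber (F.loop c) (pushOff ε (F.loop c)) = (F.twiceTB D : ℝ) / 2 := by
  classical
  filter_upwards [hF.eventually_finsum hD] with ε hε
  rw [linkingNumber, F.loop_eq_image c hc, pushOff, image_image]
  congr 2
  set S : Set (G.Dart × ℝ) := {p | p.1 ∈ D ∧ p.2 ∈ Ico (0 : ℝ) 1} with hS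
  set η : G.Dart × ℝ → Space × Space := fun p =>
    ((F.point p).1 + EuclideanSpace.single 2 ε, (F.point p).2) with hη
  have hηS : InjOn η S := by
    intro p hp q hq h
    have h1 : (F.point p).1 + EuclideanSpace.single 2 ε =
        (F.point q).1 + EuclideanSpace.single 2 ε :=
      (congrArg Prod.fst h :)
    have h2 : (F.point p).2 = (F.point q).2 := (congrArg Prod.snd h :)
    exact F.point_injOn hD hp hq (Prod.ext (add_right_cancel h1) h2)
  have tS : ∀ p ∈ S, (F.point p).2 2 = (F.point p).1 1 * (F.point p).2 0 := fun p hp =>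
    F.tangentAt p.1 (Ico_subset_Icc_self hp.2)
  have tη : ∀ p ∈ S, (η p).2 2 = (η p).1 1 * (η p).2 0 := fun p hp => by
    simpa [hη] using tS p hp
  set j : G.Dart × G.Dart → ℝ × ℝ → (G.Dart × ℝ) × (G.Dart × ℝ) := fun x p =>
    ((x.1, p.1), (x.2, p.2)) with hj
  have hjinj : ∀ x, Function.Injective (j x) := by
    rintro x ⟨s, t⟩ ⟨s', t'⟩ h
    simpa [hj] using h
  -- The crossings of the loop with its push-off, sorted by the two darts on which they lie.
  have hP : {p : (G.Dart × ℝ) × (G.Dart × ℝ) | p.1 ∈ S ∧ p.2 ∈ S ∧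
      front (F.point p.1).1 = front (η p.2).1 ∧ (F.point p.1).1 1 ≠ (η p.2).1 1} =
      ⋃ x ∈ ((D ×ˢ D : Finset (G.Dart × G.Dart)) : Set (G.Dart × G.Dart)),
        j x '' frontPairs (F.edge x.1) (F.edge x.2) (Ico 0 1) (Ico 0 1) ε := by
    ext ⟨⟨d, s⟩, ⟨d', t⟩⟩
    simp only [mem_iUnion, exists_prop, mem_image, hj, frontPairs, mem_ofPred_eq, hS, front, point,
      hη, Prod.mk.injEq, Finset.mem_coe, Finset.mem_product, Prod.exists, PiLp.add_apply]
    constructor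
    · rintro ⟨⟨hd, hs⟩, ⟨hd', ht⟩, ⟨h1, h2⟩, h3⟩
      refine ⟨d, d', ⟨hd, hd'⟩, s, t, ⟨hs, ht, ?_, ?_, ?_⟩, ⟨rfl, rfl⟩, rfl, rfl⟩
      · simpa using h1
      · simpa using h2
      · simpa using h3
    · rintro ⟨d, d', ⟨hd, hd'⟩, s, t, ⟨hs, ht, h1, h2, h3⟩, ⟨rfl, rfl⟩, rfl, rfl⟩
      exact ⟨⟨hd, hs⟩, ⟨hd', ht⟩, ⟨by simpa using h1, by simpa using h2⟩, by simpa using h3⟩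
  have hfin : ∀ x ∈ ((D ×ˢ D : Finset (G.Dart × G.Dart)) : Set (G.Dart × G.Dart)),
      (j x '' frontPairs (F.edge x.1) (F.edge x.2) (Ico 0 1) (Ico 0 1) ε).Finite := fun x hx =>
    (hε x hx).1.image _
  have hdisj : ((D ×ˢ D : Finset (G.Dart × G.Dart)) : Set (G.Dart × G.Dart)).PairwiseDisjoint
      fun x => j x '' frontPairs (F.edge x.1) (F.edge x.2) (Ico 0 1) (Ico 0 1) ε := by
    rintro x - y - hxy
    rw [Function.onFun, Set.disjoint_left]
    rintro _ ⟨p, -, rfl⟩ ⟨q, -, h⟩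
    simp only [hj, Prod.mk.injEq] at h
    exact hxy (Prod.ext h.1.1.symm h.2.1.symm)
  rw [mutualWrithe_image (F.point_injOn hD) hηS tS tη
    (hP ▸ (Finset.finite_toSet _).biUnion hfin), hP,
    finsum_mem_biUnion hdisj (Finset.finite_toSet _) hfin, finsum_mem_coe_finset,
    ← hF.sum_eq_twiceTB hD]
  refine Finset.sum_congr rfl fun x hx => ?_
  rw [finsum_mem_image (hjinj x).injOn, ← (hε x hx).2]
  rfl

end LegendrianEmbedding

namespace LegendrianEmbedding

section Reversal

variable {V : Type*} {G : SimpleGraph V} {F : LegendrianEmbedding G}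

/-! ### Reversal of edges -/

theorem _root_.LegendrianGraph.mutualWrithe_comm (A B : Set (Space × Space)) :
    mutualWrithe A B = mutualWrithe B A := add_comm _ _

/-- Reversing one strand negates its `x'` and with it the sign of every crossing. The cancellation
for disjoint edges rests on this. -/
theorem HasGenericFront.mutualWrithe_symm_left (hF : F.HasGenericFront) (d d' : G.Dart) :
    mutualWrithe (F.openEdge d.symm) (F.openEdge d') =
      -mutualWrithe (F.openEdge d) (F.openEdge d') := by
  have hinj : Function.Injective fun p : ℝ × ℝ => (1 - p.1, p.2) := by
    rintro ⟨s, t⟩ ⟨s', t'⟩ h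
    simpa using h
  have himg : F.crossPairs d.symm d' = (fun p : ℝ × ℝ => (1 - p.1, p.2)) '' F.crossPairs d d' := by
    ext ⟨s, t⟩
    have hs : s ∈ Ioo (0 : ℝ) 1 ↔ 1 - s ∈ Ioo (0 : ℝ) 1 := by
      simp only [mem_Ioo]
      constructor <;> rintro ⟨h1, h2⟩ <;> constructor <;> linarith
    have h1 : ((s, t) : ℝ × ℝ) = (fun p : ℝ × ℝ => (1 - p.1, p.2)) (1 - s, t) := by simp
    rw [h1, hinj.mem_set_image, crossPairs, crossPairs, frontPairs, frontPairs, mem_ofPred_eq,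
      mem_ofPred_eq, edge_symm_eq]
    simp only [sub_sub_cancel, hs]
  rw [hF.mutualWrithe_openEdge, hF.mutualWrithe_openEdge, himg, finsum_mem_image hinj.injOn,
    ← finsum_mem_neg_distrib]
  · refine finsum_mem_congr rfl fun p _ => ?_
    simp only [pairSign, deriv_edge_symm_coord, sub_sub_cancel, neg_mul, Left.sign_neg,
      SignType.coe_neg]
  · exact hF.finite_crossPairs d d'

theorem HasGenericFront.mutualWrithe_symm_right (hF : F.HasGenericFront) (d d' : G.Dart) :
    mutualWrithe (F.openEdge d) (F.openEdge d'.symm) =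
      -mutualWrithe (F.openEdge d) (F.openEdge d') := by
  rw [mutualWrithe_comm, hF.mutualWrithe_symm_left, mutualWrithe_comm]

theorem HasGenericFront.mutualWrithe_symm_symm (hF : F.HasGenericFront) (d d' : G.Dart) :
    mutualWrithe (F.openEdge d.symm) (F.openEdge d'.symm) =
      mutualWrithe (F.openEdge d) (F.openEdge d') := by
  rw [hF.mutualWrithe_symm_left, hF.mutualWrithe_symm_right, neg_neg]

theorem mutualWrithe_self (A : Set (Space × Space)) : mutualWrithe A A = 2 * writhe A :=
  (two_mul _).symm

theorem HasGenericFront.writhe_symm (hF : F.HasGenericFront) (d : G.Dart) :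
    writhe (F.openEdge d.symm) = writhe (F.openEdge d) := by
  have := hF.mutualWrithe_symm_symm d d
  rw [mutualWrithe_self, mutualWrithe_self] at this
  omega

theorem cuspsAlongEdge_symm (F : LegendrianEmbedding G) (d : G.Dart) :
    F.cuspsAlongEdge d.symm = F.cuspsAlongEdge d := by
  have hinj : Function.Injective fun t : ℝ => 1 - t := sub_right_injective
  have : {t ∈ Ioo (0 : ℝ) 1 | deriv (F.edge d.symm) t 0 = 0} =
      (fun t : ℝ => 1 - t) '' {t ∈ Ioo (0 : ℝ) 1 | deriv (F.edge d) t 0 = 0} := by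
    ext t
    have ht : t ∈ Ioo (0 : ℝ) 1 ↔ 1 - t ∈ Ioo (0 : ℝ) 1 := by
      simp only [mem_Ioo]
      constructor <;> rintro ⟨h1, h2⟩ <;> constructor <;> linarith
    have h1 : t = (fun t : ℝ => 1 - t) (1 - t) := by simp
    conv_rhs => rw [h1, hinj.mem_set_image]
    rw [mem_ofPred_eq, mem_ofPred_eq, deriv_edge_symm_coord, neg_eq_zero, ht]
  rw [cuspsAlongEdge, cuspsAlongEdge, this, ncard_image_of_injective _ hinj]

/-- Independence of orientation: every crossing sign changes twice, and the two edges at a vertex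
exchange their roles. -/
theorem HasGenericFront.twiceTB_map_symm (hF : F.HasGenericFront) (D : Finset G.Dart) :
    F.twiceTB (D.map ⟨SimpleGraph.Dart.symm, SimpleGraph.Dart.symm_involutive.injective⟩) =
      F.twiceTB D := by
  classical
  simp only [twiceTB, Finset.sum_map, Function.Embedding.coeFn_mk, hF.mutualWrithe_symm_symm,
    cuspsAlongEdge_symm, SimpleGraph.Dart.symm_symm]
  congr 1
  rw [Finset.sum_comm]
  refine Finset.sum_congr rfl fun d _ => Finset.sum_congr rfl fun d' _ => ?_
  exact if_congr (F.sameSide_comm _ _) rfl rfl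

end Reversal

end LegendrianEmbedding

/-! ### Cycles of a complete graph as cyclic sequences of vertices -/

section CyclicSequences

variable {V : Type*}

/-- The dart of the complete graph between two members of a family of distinct vertices. -/
def embDart {ι : Type*} (f : ι ↪ V) {a b : ι} (h : a ≠ b) : (⊤ : SimpleGraph V).Dart :=
  ⟨(f a, f b), fun e => h (f.injective e)⟩

theorem two_ne_zero_of_three_le {r : ℕ} (hr : 3 ≤ r) : (2 : ZMod r) ≠ 0 := by
  intro h
  have h' : ((2 : ℕ) : ZMod r) = 0 := by exact_mod_cast h
  rw [ZMod.natCast_eq_zero_iff] at h'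
  have := Nat.le_of_dvd two_pos h'
  omega

section Darts

variable {r : ℕ} [Fact (1 < r)]

theorem ne_add_one (i : ZMod r) : i ≠ i + 1 := by simp

/-- The `i`-th dart of a cyclic sequence of vertices. -/
def cycDart (f : ZMod r ↪ V) (i : ZMod r) : (⊤ : SimpleGraph V).Dart := embDart f (ne_add_one i)

theorem cycDart_injective (f : ZMod r ↪ V) : Function.Injective (cycDart f) := fun _ _ h =>
  f.injective (congrArg (fun d : (⊤ : SimpleGraph V).Dart => d.fst) h)

end Darts

variable {r : ℕ} [NeZero r]

open Classical in
/-- The edges of a cyclic sequence of vertices. -/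
noncomputable def cycEdges (f : ZMod r ↪ V) : Finset (Sym2 V) :=
  Finset.univ.image fun i => s(f i, f (i + 1))

theorem mem_cycEdges {f : ZMod r ↪ V} {e : Sym2 V} :
    e ∈ cycEdges f ↔ ∃ i, s(f i, f (i + 1)) = e := by
  simp [cycEdges]

open Classical in
theorem card_cycEdges (hr : 3 ≤ r) (f : ZMod r ↪ V) : (cycEdges f).card = r := by
  rw [cycEdges, Finset.card_image_of_injective, Finset.card_univ, ZMod.card]
  intro i j h
  rcases Sym2.eq_iff.1 h with ⟨h1, -⟩ | ⟨h1, h2⟩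
  · exact f.injective h1
  · have h1 := f.injective h1
    have h2 := f.injective h2
    exact absurd (by linear_combination h2 - h1) (two_ne_zero_of_three_le hr)

/-- Induction along the cycle: at the current vertex the next edge is the one that does not lead
back to the previous vertex, since `2 ≠ 0` in `ZMod r`. -/
theorem eq_of_cycEdges_eq (hr : 3 ≤ r) {f g : ZMod r ↪ V} (h : cycEdges f = cycEdges g)
    (h0 : f 0 = g 0) (h1 : f 1 = g 1) : f = g := by
  have key : ∀ k : ℕ, f k = g k ∧ f (k + 1) = g (k + 1) := by
    intro k
    induction k with
    | zero => simpa using ⟨h0, h1⟩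
    | succ k ih =>
      rw [Nat.cast_succ]
      refine ⟨ih.2, ?_⟩
      have : s(f (k + 1), f (k + 1 + 1)) ∈ cycEdges g := h ▸ mem_cycEdges.2 ⟨_, rfl⟩
      obtain ⟨j, hj⟩ := mem_cycEdges.1 this
      rw [ih.2] at hj
      rcases Sym2.eq_iff.1 hj with ⟨e1, e2⟩ | ⟨e1, e2⟩
      · rw [← e2, g.injective e1]
      · have hjk : j = k := add_right_cancel (g.injective e2)
        rw [hjk, ← ih.1] at e1
        have := f.injective e1
        exact absurd (by linear_combination -this) (two_ne_zero_of_three_le hr)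
  ext i
  rw [← ZMod.natCast_zmod_val i]
  exact (key _).1

/-- The cyclic sequence started `j` steps later. -/
def rot (f : ZMod r ↪ V) (j : ZMod r) : ZMod r ↪ V := (Equiv.addRight j).toEmbedding.trans f

/-- The reversed cyclic sequence, started at the `j`-th vertex. -/
def refl (f : ZMod r ↪ V) (j : ZMod r) : ZMod r ↪ V := (Equiv.subLeft j).toEmbedding.trans f

variable [Fact (1 < r)]

/-- The darts of a cyclic sequence of vertices. -/
def cycDarts (f : ZMod r ↪ V) : Finset (⊤ : SimpleGraph V).Dart :=
  Finset.univ.map ⟨cycDart f, cycDart_injective f⟩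

theorem mem_cycDarts {f : ZMod r ↪ V} {d : (⊤ : SimpleGraph V).Dart} :
    d ∈ cycDarts f ↔ ∃ i, cycDart f i = d := by
  simp [cycDarts]

theorem isCyclic_cycDarts (hr : 3 ≤ r) (f : ZMod r ↪ V) :
    LegendrianEmbedding.IsCyclic (cycDarts f) := by
  refine ⟨?_, ?_, ?_⟩
  · intro d hd d' hd' h
    obtain ⟨i, rfl⟩ := mem_cycDarts.1 hd
    obtain ⟨j, rfl⟩ := mem_cycDarts.1 hd'
    rw [f.injective h]
  · intro d hd d' hd' h
    obtain ⟨i, rfl⟩ := mem_cycDarts.1 hd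
    obtain ⟨j, rfl⟩ := mem_cycDarts.1 hd'
    rw [add_right_cancel (f.injective h)]
  · intro d hd hd'
    obtain ⟨i, rfl⟩ := mem_cycDarts.1 hd
    obtain ⟨j, hj⟩ := mem_cycDarts.1 hd'
    have h1 : j = i + 1 := f.injective (congrArg (fun d : (⊤ : SimpleGraph V).Dart => d.fst) hj)
    have h2 : j + 1 = i := f.injective (congrArg (fun d : (⊤ : SimpleGraph V).Dart => d.snd) hj)
    refine two_ne_zero_of_three_le hr ?_
    linear_combination h2 - h1

end CyclicSequences

section CyclicWalks

variable {V : Type*} {r : ℕ} [NeZero r] [Fact (1 < r)]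

theorem cycDarts_rot (f : ZMod r ↪ V) (j : ZMod r) : cycDarts (rot f j) = cycDarts f := by
  have hd : ∀ i, cycDart (rot f j) i = cycDart f (i + j) := fun i => by
    refine SimpleGraph.Dart.ext _ _ (Prod.ext rfl ?_)
    change f (i + 1 + j) = f (i + j + 1)
    congr 1; ring
  ext d
  simp only [mem_cycDarts, hd]
  exact ((Equiv.addRight j).surjective.exists (p := fun i => cycDart f i = d)).symm

theorem cycDarts_refl (f : ZMod r ↪ V) (j : ZMod r) : cycDarts (refl f j) =
    (cycDarts f).map ⟨SimpleGraph.Dart.symm, SimpleGraph.Dart.symm_involutive.injective⟩ := by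
  have hd : ∀ i, cycDart (refl f j) i = (cycDart f (j - 1 - i)).symm := fun i => by
    refine SimpleGraph.Dart.ext _ _ (Prod.ext ?_ ?_)
    · change f (j - i) = f (j - 1 - i + 1)
      congr 1; ring
    · change f (j - (i + 1)) = f (j - 1 - i)
      congr 1; ring
  ext d
  simp only [mem_cycDarts, hd, Finset.mem_map, Function.Embedding.coeFn_mk, exists_exists_eq_and]
  exact ((Equiv.subLeft (j - 1)).surjective.exists (p := fun i => (cycDart f i).symm = d)).symm

theorem mem_cycEdges_iff_cycDarts {f : ZMod r ↪ V} {e : Sym2 V} :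
    e ∈ cycEdges f ↔ ∃ d ∈ cycDarts f, d.edge = e := by
  simp only [mem_cycEdges, mem_cycDarts, exists_exists_eq_and]
  rfl

theorem cycEdges_rot (f : ZMod r ↪ V) (j : ZMod r) : cycEdges (rot f j) = cycEdges f := by
  ext e
  rw [mem_cycEdges_iff_cycDarts, mem_cycEdges_iff_cycDarts, cycDarts_rot]

theorem cycEdges_refl (f : ZMod r ↪ V) (j : ZMod r) : cycEdges (refl f j) = cycEdges f := by
  ext e
  rw [mem_cycEdges_iff_cycDarts, mem_cycEdges_iff_cycDarts, cycDarts_refl]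
  simp

/-- The first edge of `g` is some edge of `f`, run through in the same or the opposite direction. A
rotation or a reflection of `f` then agrees with `g` at two consecutive vertices, hence everywhere.
-/
theorem cycEdges_eq_iff (hr : 3 ≤ r) {f g : ZMod r ↪ V} :
    cycEdges g = cycEdges f ↔ (∃ j, g = rot f j) ∨ ∃ j, g = refl f j := by
  constructor
  · intro h
    have : s(g 0, g (0 + 1)) ∈ cycEdges f := h ▸ mem_cycEdges.2 ⟨0, rfl⟩
    obtain ⟨j, hj⟩ := mem_cycEdges.1 this
    rw [zero_add] at hj
    rcases Sym2.eq_iff.1 hj with ⟨h0, h1⟩ | ⟨h0, h1⟩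
    · refine Or.inl ⟨j, eq_of_cycEdges_eq hr (by rw [h, cycEdges_rot]) ?_ ?_⟩
      · change g 0 = f (0 + j)
        rw [zero_add, h0]
      · change g 1 = f (1 + j)
        rw [add_comm, h1]
    · refine Or.inr ⟨j + 1, eq_of_cycEdges_eq hr (by rw [h, cycEdges_refl]) ?_ ?_⟩
      · change g 0 = f (j + 1 - 0)
        rw [sub_zero, h1]
      · change g 1 = f (j + 1 - 1)
        rw [add_sub_cancel_right, h0]
  · rintro (⟨j, rfl⟩ | ⟨j, rfl⟩)
    · exact cycEdges_rot f j
    · exact cycEdges_refl f j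

open Classical in
theorem card_cycEdges_fiber [Fintype V] (hr : 3 ≤ r) (f : ZMod r ↪ V) :
    (Finset.univ.filter fun g : ZMod r ↪ V => cycEdges g = cycEdges f).card = 2 * r := by
  have himg : (Finset.univ.filter fun g : ZMod r ↪ V => cycEdges g = cycEdges f) =
      (Finset.univ : Finset (ZMod r ⊕ ZMod r)).image (Sum.elim (rot f) (refl f)) := by
    ext g
    simp [cycEdges_eq_iff hr, eq_comm]
  rw [himg, Finset.card_image_of_injective, Finset.card_univ, Fintype.card_sum, ZMod.card,
    two_mul]
  -- A rotation increases the index and a reflection decreases it; the two differ because `2 ≠ 0`.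
  have hne : ∀ i j, rot f i ≠ refl f j := by
    intro i j h
    have h0 : f (0 + i) = f (j - 0) := DFunLike.congr_fun h 0
    have h1 : f (1 + i) = f (j - 1) := DFunLike.congr_fun h 1
    have h0 := f.injective h0
    have h1 := f.injective h1
    exact two_ne_zero_of_three_le hr (by linear_combination h1 - h0)
  rintro (i | i) (j | j) h
  · have h0 : f (0 + i) = f (0 + j) := DFunLike.congr_fun h 0
    rw [add_left_cancel (f.injective h0)]
  · exact absurd h (hne i j)
  · exact absurd h.symm (hne j i)
  · have h0 : f (i - 0) = f (j - 0) := DFunLike.congr_fun h 0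
    rw [sub_left_injective (f.injective h0)]

/-- The vertices of a cycle form a cyclic sequence. -/
theorem exists_cyclicSequence {v : V} {c : (⊤ : SimpleGraph V).Walk v v} (hc : c.IsCycle)
    (hr : c.length = r) :
    ∃ f : ZMod r ↪ V, (∀ i, f i = c.getVert i.val) ∧ ∀ d, d ∈ c.darts ↔ d ∈ cycDarts f := by
  have hinj : Function.Injective fun i : ZMod r => c.getVert i.val := by
    intro i j h
    refine ZMod.val_injective r (hc.getVert_injOn' ?_ ?_ h)
    · have := i.val_lt
      simp only [mem_ofPred_eq]
      omega
    · have := j.val_lt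
      simp only [mem_ofPred_eq]
      omega
  have hsucc : ∀ i : ZMod r, c.getVert (i + 1).val = c.getVert (i.val + 1) := by
    intro i
    have hi := i.val_lt
    have h1 : (1 : ZMod r).val = 1 := ZMod.val_one'' (Fact.out : 1 < r).ne'
    rcases lt_or_ge (i.val + 1) r with h | h
    · rw [ZMod.val_add_of_lt (by rwa [h1]), h1]
    -- Wrap-around: the walk is closed, so its vertex number `r` is its vertex number `0`.
    · have h2 : i.val + 1 = r := by omega
      have h3 : (i + 1).val = 0 := by
        rw [ZMod.val_add, h1, h2, Nat.mod_self]
      rw [h2, h3, ← hr, c.getVert_length, c.getVert_zero]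
  refine ⟨⟨_, hinj⟩, fun _ => rfl, fun d => ?_⟩
  rw [mem_cycDarts, List.mem_iff_getElem]
  have hdart : ∀ (k : ℕ) (hk : k < c.darts.length) (i : ZMod r), i.val = k →
      cycDart ⟨_, hinj⟩ i = c.darts[k] := by
    rintro k hk i rfl
    rw [c.darts_getElem_eq_getVert]
    exact SimpleGraph.Dart.ext _ _ (Prod.ext rfl (hsucc i))
  constructor
  · rintro ⟨k, hk, rfl⟩
    refine ⟨k, hdart k hk _ (ZMod.val_cast_of_lt ?_)⟩
    rwa [c.length_darts, hr] at hk
  · rintro ⟨i, rfl⟩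
    have hi : i.val < c.darts.length := by
      rw [c.length_darts, hr]
      exact i.val_lt
    exact ⟨i.val, hi, (hdart _ hi i rfl).symm⟩

theorem mem_edges_iff_of_darts {v : V} {c : (⊤ : SimpleGraph V).Walk v v} {f : ZMod r ↪ V}
    (h : ∀ d, d ∈ c.darts ↔ d ∈ cycDarts f) (e : Sym2 V) : e ∈ c.edges ↔ e ∈ cycEdges f := by
  simp only [SimpleGraph.Walk.edges, List.mem_map, h, mem_cycEdges_iff_cycDarts]

theorem isCycleEdgeSet_cycEdges (hr : 3 ≤ r) (f : ZMod r ↪ V) :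
    IsCycleEdgeSet (⊤ : SimpleGraph V) (cycEdges f) := by
  obtain ⟨m, rfl⟩ : ∃ m, r = m + 3 := ⟨r - 3, by omega⟩
  let φ : SimpleGraph.cycleGraph (m + 3) →g (⊤ : SimpleGraph V) :=
    ⟨fun i : Fin (m + 3) => f i, fun {a b} hab e => hab.ne (f.injective e)⟩
  have hφ : Function.Injective φ := f.injective
  have hc : ((SimpleGraph.cycleGraph.cycle m).map φ).IsCycle :=
    (SimpleGraph.Walk.isCycle_map_iff_of_injective hφ).2 SimpleGraph.cycleGraph.isCycle_cycle
  obtain ⟨g, hg, hgd⟩ := exists_cyclicSequence (r := m + 3) hc (by simp)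
  -- The standard cycle of `cycleGraph` visits the vertices in decreasing order, so its image is the
  -- reflection of `f`, which has the same edges.
  have hgf : g = refl f 0 := by
    ext i
    have hi := i.val_lt
    rw [hg, SimpleGraph.Walk.getVert_map, SimpleGraph.cycleGraph.getVert_cycle hi.le]
    change f _ = f (0 - i)
    congr 1
  refine ⟨⟨_, (SimpleGraph.cycleGraph.cycle m).map φ⟩, hc, fun e => ?_⟩
  rw [mem_edges_iff_of_darts hgd, hgf, cycEdges_refl]

end CyclicWalks

theorem length_eq_card_of_edges {V : Type*} {G : SimpleGraph V} {v : V} {c : G.Walk v v}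
    (hc : c.IsCycle) {S : Finset (Sym2 V)} (hS : ∀ e, e ∈ S ↔ e ∈ c.edges) :
    c.length = S.card := by
  classical
  have : S = c.edges.toFinset := by
    ext e
    rw [hS, List.mem_toFinset]
  rw [this, List.toFinset_card_of_nodup hc.edges_nodup, SimpleGraph.Walk.length_edges]

/-- Every cycle edge set is the edge set of a cyclic sequence of vertices. -/
theorem IsCycleEdgeSet.exists_cycEdges {V : Type*} {S : Finset (Sym2 V)}
    (h : IsCycleEdgeSet (⊤ : SimpleGraph V) S) {r : ℕ} [NeZero r] [Fact (1 < r)]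
    (hr : S.card = r) : ∃ f : ZMod r ↪ V, cycEdges f = S := by
  obtain ⟨⟨v, c⟩, hc, hS⟩ := h
  obtain ⟨f, -, hf⟩ := exists_cyclicSequence hc ((length_eq_card_of_edges hc hS).trans hr)
  refine ⟨f, ?_⟩
  ext e
  rw [hS, mem_edges_iff_of_darts hf]

theorem IsCycleEdgeSet.three_le_card {V : Type*} {G : SimpleGraph V} {S : Finset (Sym2 V)}
    (h : IsCycleEdgeSet G S) : 3 ≤ S.card := by
  obtain ⟨⟨v, c⟩, hc, hS⟩ := h
  exact length_eq_card_of_edges hc hS ▸ hc.three_le_length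

theorem IsCycleEdgeSet.card_le {V : Type*} [Fintype V] {S : Finset (Sym2 V)}
    (h : IsCycleEdgeSet (⊤ : SimpleGraph V) S) : S.card ≤ Fintype.card V := by
  have h3 := h.three_le_card
  have : NeZero S.card := ⟨by omega⟩
  have : Fact (1 < S.card) := ⟨by omega⟩
  obtain ⟨f, -⟩ := h.exists_cycEdges rfl
  simpa [ZMod.card] using Fintype.card_le_of_embedding f

/-! ### The invariant `tb` of the cycles of a complete graph -/

namespace LegendrianEmbedding

variable {V : Type*} {F : LegendrianEmbedding (⊤ : SimpleGraph V)} {r : ℕ} [NeZero r]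
  [Fact (1 < r)]

theorem HasGenericFront.twiceTB_eq_of_cycEdges_eq (hF : F.HasGenericFront) (hr : 3 ≤ r)
    {f g : ZMod r ↪ V} (h : cycEdges g = cycEdges f) :
    F.twiceTB (cycDarts g) = F.twiceTB (cycDarts f) := by
  rcases (cycEdges_eq_iff hr).1 h with ⟨j, rfl⟩ | ⟨j, rfl⟩
  · rw [cycDarts_rot]
  · rw [cycDarts_refl, hF.twiceTB_map_symm]

/-- Well-definedness of `tb`: the value is fixed by the edge set, so neither base point nor
direction of the closed walk matters. -/
theorem HasGenericFront.eventually_linkingNumber_cycle (hF : F.HasGenericFront) (hr : 3 ≤ r)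
    {v : V} {c : (⊤ : SimpleGraph V).Walk v v} (hc : c.IsCycle) (f : ZMod r ↪ V)
    (h : ∀ e, e ∈ c.edges ↔ e ∈ cycEdges f) :
    ∀ᶠ ε in 𝓝[>] (0 : ℝ), linkingNumber (F.loop c) (pushOff ε (F.loop c)) =
      (F.twiceTB (cycDarts f) : ℝ) / 2 := by
  have hlen : c.length = r :=
    (length_eq_card_of_edges hc fun e => (h e).symm).trans (card_cycEdges hr f)
  obtain ⟨g, -, hg⟩ := exists_cyclicSequence hc hlen
  have hgf : cycEdges g = cycEdges f := by
    ext e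
    rw [← mem_edges_iff_of_darts hg, h]
  rw [← hF.twiceTB_eq_of_cycEdges_eq hr hgf]
  exact hF.eventually_linkingNumber c (isCyclic_cycDarts hr g) hg

theorem HasGenericFront.tb_cycEdges (hF : F.HasGenericFront) (hr : 3 ≤ r) (f : ZMod r ↪ V) :
    F.tb (cycEdges f) = (F.twiceTB (cycDarts f) : ℝ) / 2 := by
  have h := isCycleEdgeSet_cycEdges hr f
  rw [tb, dif_pos h, thurstonBennequin]
  refine Tendsto.limUnder_eq (tendsto_const_nhds.congr' ?_)
  filter_upwards [hF.eventually_linkingNumber_cycle hr h.choose_spec.1 f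
    fun e => (h.choose_spec.2 e).symm] with ε hε using hε.symm

end LegendrianEmbedding

/-! ### Sums over embeddings -/

section Counting

/-- Permutations of `V` act transitively on injective `k`-tuples, so every tuple has equally many
extensions to `ι`. -/
theorem sum_comp_embedding {ι V : Type*} [Fintype ι] [Fintype V] {k : ℕ} [Fintype (ι ↪ V)]
    [Fintype (Fin k ↪ V)] (h : Fin k ↪ ι) (hc : Fintype.card ι ≤ Fintype.card V)
    (g : (Fin k ↪ V) → ℝ) :
    ∑ f : ι ↪ V, g (h.trans f) =
      ((Fintype.card V - k).factorial : ℝ) / ((Fintype.card V - Fintype.card ι).factorial : ℝ) *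
        ∑ e, g e := by
  classical
  set N : (Fin k ↪ V) → ℕ := fun e => (Finset.univ.filter fun f : ι ↪ V => h.trans f = e).card
    with hN
  have hle : ∀ e e', N e ≤ N e' := by
    intro e e'
    have := Equiv.Perm.isMultiplyPretransitive V k
    obtain ⟨σ, hσ⟩ := MulAction.exists_smul_eq (Equiv.Perm V) e e'
    refine Finset.card_le_card_of_injOn (fun f => f.trans σ.toEmbedding) ?_ ?_
    · intro f hf
      simp only [Finset.coe_filter, Finset.mem_univ, true_and, mem_ofPred_eq] at hf ⊢
      rw [← hσ, ← hf]
      rfl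
    · intro f _ f' _ hff'
      ext i
      exact σ.injective (DFunLike.congr_fun hff' i)
  have hkn : k ≤ Fintype.card V :=
    le_trans (by simpa using Fintype.card_le_of_embedding h) hc
  obtain ⟨e₀⟩ : Nonempty (Fin k ↪ V) :=
    Function.Embedding.nonempty_of_card_le (by simpa using hkn)
  have hNe : ∀ e, N e = N e₀ := fun e => le_antisymm (hle _ _) (hle _ _)
  have hsum : ∀ g : (Fin k ↪ V) → ℝ, ∑ f : ι ↪ V, g (h.trans f) = N e₀ * ∑ e, g e := by
    intro g
    rw [← Finset.sum_fiberwise_of_maps_to (s := Finset.univ) (t := Finset.univ)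
      (g := fun f : ι ↪ V => h.trans f) (fun _ _ => Finset.mem_univ _), Finset.mul_sum]
    refine Finset.sum_congr rfl fun e _ => ?_
    rw [Finset.sum_congr rfl fun f hf => by rw [(Finset.mem_filter.1 hf).2], Finset.sum_const,
      nsmul_eq_mul, ← hNe e]
  -- The constant function `1` computes that common number: a quotient of two falling factorials.
  have hcard := hsum fun _ => 1
  simp only [Finset.sum_const, Finset.card_univ, nsmul_eq_mul, mul_one,
    Fintype.card_embedding_eq, Fintype.card_fin] at hcard
  have f1 : ((Fintype.card V - Fintype.card ι).factorial : ℝ) *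
      ((Fintype.card V).descFactorial (Fintype.card ι) : ℝ) = (Fintype.card V).factorial := by
    exact_mod_cast Nat.factorial_mul_descFactorial hc
  have f2 : ((Fintype.card V - k).factorial : ℝ) *
      ((Fintype.card V).descFactorial k : ℝ) = (Fintype.card V).factorial := by
    exact_mod_cast Nat.factorial_mul_descFactorial hkn
  have p0 : ((Fintype.card V).factorial : ℝ) ≠ 0 := by positivity
  have p1 : ((Fintype.card V - Fintype.card ι).factorial : ℝ) ≠ 0 := by positivity
  have p2 : ((Fintype.card V).descFactorial k : ℝ) ≠ 0 := by
    intro h0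
    rw [h0, mul_zero] at f2
    exact p0 f2.symm
  rw [hsum g]
  congr 1
  rw [eq_div_iff p1]
  refine mul_right_cancel₀ p2 ?_
  rw [f2, ← f1, hcard]
  ring

theorem sum_eq_two_mul_sum_filter {α : Type*} [Fintype α] (τ : Equiv.Perm α) (P : α → Prop)
    [DecidablePred P] (hP : ∀ a, P (τ a) ↔ ¬P a) {g : α → ℝ} (hg : ∀ a, g (τ a) = g a) :
    ∑ a, g a = 2 * ∑ a with P a, g a := by
  rw [← Finset.sum_filter_add_sum_filter_not Finset.univ P, two_mul]
  congr 1
  exact Finset.sum_equiv τ (by simp [hP]) (fun a _ => (hg a).symm)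

/-- Composition of embeddings with a permutation of the index set. -/
def precomp {ι V : Type*} (σ : Equiv.Perm ι) : Equiv.Perm (ι ↪ V) where
  toFun f := σ.toEmbedding.trans f
  invFun f := σ.symm.toEmbedding.trans f
  left_inv f := by ext; simp
  right_inv f := by ext; simp

variable {V : Type*}

theorem exists_embedding_two {a b : V} (hab : a ≠ b) : ∃ e : Fin 2 ↪ V, e 0 = a ∧ e 1 = b := by
  refine ⟨⟨![a, b], fun i j h => ?_⟩, rfl, rfl⟩
  fin_cases i <;> fin_cases j <;> simp_all

theorem exists_embedding_three {a b c : V} (hab : a ≠ b) (hbc : b ≠ c) (hac : a ≠ c) :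
    ∃ e : Fin 3 ↪ V, e 0 = a ∧ e 1 = b ∧ e 2 = c := by
  refine ⟨⟨![a, b, c], fun i j h => ?_⟩, rfl, rfl, rfl⟩
  fin_cases i <;> fin_cases j <;> simp_all

theorem zero_ne_one_fin_two : (0 : Fin 2) ≠ 1 := by decide

theorem sum_embDart [Fintype V] [Fintype (Fin 2 ↪ V)] [Fintype (⊤ : SimpleGraph V).Dart]
    (g : (⊤ : SimpleGraph V).Dart → ℝ) :
    ∑ e : Fin 2 ↪ V, g (embDart e zero_ne_one_fin_two) = ∑ d, g d := by
  refine Fintype.sum_bijective (fun e : Fin 2 ↪ V => embDart e zero_ne_one_fin_two) ⟨?_, ?_⟩ _ _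
    fun _ => rfl
  · intro e e' h
    ext i
    fin_cases i
    · exact congrArg (fun d : (⊤ : SimpleGraph V).Dart => d.fst) h
    · exact congrArg (fun d : (⊤ : SimpleGraph V).Dart => d.snd) h
  · intro d
    obtain ⟨e, h0, h1⟩ := exists_embedding_two d.fst_ne_snd
    exact ⟨e, SimpleGraph.Dart.ext _ _ (Prod.ext h0 h1)⟩

end Counting

/-! ### The counts of the theorem as sums over darts and over paths of two edges -/

namespace LegendrianEmbedding

variable {V : Type*} {F : LegendrianEmbedding (⊤ : SimpleGraph V)}

theorem symm_lt_iff [LinearOrder V]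
    (d : (⊤ : SimpleGraph V).Dart) :
    d.symm.fst < d.symm.snd ↔ ¬d.fst < d.snd := by
  rw [not_lt]
  exact ⟨fun h => h.le, fun h => lt_of_le_of_ne h d.fst_ne_snd.symm⟩

theorem HasGenericFront.sum_writhe [Fintype V] [LinearOrder V]
    [DecidableRel (⊤ : SimpleGraph V).Adj]
    (hF : F.HasGenericFront) :
    ∑ d, (writhe (F.openEdge d) : ℝ) = 2 * F.edgeWrithe := by
  rw [edgeWrithe, Int.cast_sum]
  exact sum_eq_two_mul_sum_filter (SimpleGraph.Dart.symm_involutive.toPerm _)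
    (fun d : (⊤ : SimpleGraph V).Dart => d.fst < d.snd) symm_lt_iff
    (fun d => congrArg _ (hF.writhe_symm d))

theorem sum_cuspsAlongEdge [Fintype V] [LinearOrder V]
    [DecidableRel (⊤ : SimpleGraph V).Adj]
    (F : LegendrianEmbedding (⊤ : SimpleGraph V)) :
    ∑ d, (F.cuspsAlongEdge d : ℝ) = 2 * F.edgeCusps := by
  rw [edgeCusps, Nat.cast_sum]
  exact sum_eq_two_mul_sum_filter (SimpleGraph.Dart.symm_involutive.toPerm _)
    (fun d : (⊤ : SimpleGraph V).Dart => d.fst < d.snd) symm_lt_iff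
    (fun d => congrArg _ (F.cuspsAlongEdge_symm d))

theorem _root_.LegendrianGraph.zero_ne_one_fin_three : (0 : Fin 3) ≠ 1 := by decide

theorem _root_.LegendrianGraph.one_ne_two_fin_three : (1 : Fin 3) ≠ 2 := by decide

theorem precomp_rev_lt_iff [LinearOrder V]
    (e : Fin 3 ↪ V) :
    precomp Fin.revPerm e 0 < precomp Fin.revPerm e 2 ↔ ¬e 0 < e 2 := by
  rw [not_lt]
  exact ⟨fun h => h.le, fun h => lt_of_le_of_ne h (e.injective.ne (by decide))⟩

/-- An embedding of `Fin 3` is an oriented path of two edges, one leading into the middle vertex and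
the other out of it. Reversing the path preserves the summand and exchanges `e 0 < e 2` with its
negation, whence the factor `2`. -/
theorem HasGenericFront.sum_mutualWrithe_adjacent [Fintype V] [LinearOrder V]
    [DecidableRel (⊤ : SimpleGraph V).Adj]
    (hF : F.HasGenericFront) :
    ∑ e : Fin 3 ↪ V, (mutualWrithe (F.openEdge (embDart e zero_ne_one_fin_three))
      (F.openEdge (embDart e one_ne_two_fin_three)) : ℝ) = 2 * F.adjacentEdgeWrithe := by
  rw [sum_eq_two_mul_sum_filter (precomp Fin.revPerm) (fun e : Fin 3 ↪ V => e 0 < e 2)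
    precomp_rev_lt_iff]
  · rw [adjacentEdgeWrithe, Int.cast_sum]
    congr 1
    refine Finset.sum_bij
      (fun e _ => (embDart e zero_ne_one_fin_three, embDart e one_ne_two_fin_three)) ?_ ?_ ?_ ?_
    · intro e he
      exact Finset.mem_filter.2 ⟨Finset.mem_univ _, rfl, (Finset.mem_filter.1 he).2⟩
    · intro e _ e' _ h
      obtain ⟨h1, h2⟩ := Prod.mk.inj h
      ext i
      fin_cases i
      · exact congrArg (fun d : (⊤ : SimpleGraph V).Dart => d.fst) h1
      · exact congrArg (fun d : (⊤ : SimpleGraph V).Dart => d.snd) h1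
      · exact congrArg (fun d : (⊤ : SimpleGraph V).Dart => d.snd) h2
    · rintro ⟨d, d'⟩ hp
      obtain ⟨hdd, hlt⟩ := (Finset.mem_filter.1 hp).2
      obtain ⟨e, h0, h1, h2⟩ := exists_embedding_three d.fst_ne_snd (hdd ▸ d'.fst_ne_snd) hlt.ne
      refine ⟨e, Finset.mem_filter.2 ⟨Finset.mem_univ _, ?_⟩, Prod.ext ?_ ?_⟩
      · rw [h0, h2]
        exact hlt
      · exact SimpleGraph.Dart.ext _ _ (Prod.ext h0 h1)
      · exact SimpleGraph.Dart.ext _ _ (Prod.ext (h1.trans hdd) h2)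
    · intro e _
      rfl
  · intro e
    have h1 : embDart (precomp Fin.revPerm e) zero_ne_one_fin_three =
      (embDart e one_ne_two_fin_three).symm := rfl
    have h2 : embDart (precomp Fin.revPerm e) one_ne_two_fin_three =
      (embDart e zero_ne_one_fin_three).symm := rfl
    rw [h1, h2, hF.mutualWrithe_symm_symm, mutualWrithe_comm]

open Classical in
theorem sum_sameSide [Fintype V] [LinearOrder V]
    [DecidableRel (⊤ : SimpleGraph V).Adj]
    (F : LegendrianEmbedding (⊤ : SimpleGraph V)) :
    ∑ e : Fin 3 ↪ V, (if F.SameSide (embDart e zero_ne_one_fin_three).symm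
      (embDart e one_ne_two_fin_three) then (1 : ℝ) else 0) = 2 * F.vertexCusps := by
  rw [sum_eq_two_mul_sum_filter (precomp Fin.revPerm) (fun e : Fin 3 ↪ V => e 0 < e 2)
    precomp_rev_lt_iff]
  · rw [vertexCusps]
    congr 1
    rw [Finset.sum_boole, Finset.filter_filter]
    congr 1
    simp only [cuspsAtVertex]
    rw [← Finset.card_biUnion]
    -- Here the path is read as two edges leaving the middle vertex `e 1`, so the first dart is
    -- reversed.
    · refine Finset.card_bij
        (fun e _ => ((embDart e zero_ne_one_fin_three).symm, embDart e one_ne_two_fin_three))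
        ?_ ?_ ?_
      · intro e he
        obtain ⟨-, hlt, hs⟩ := Finset.mem_filter.1 he
        exact Finset.mem_biUnion.2 ⟨e 1, Finset.mem_univ _,
          Finset.mem_filter.2 ⟨Finset.mem_univ _, rfl, rfl, hlt, hs.2⟩⟩
      · intro e _ e' _ h
        obtain ⟨h1, h2⟩ := Prod.mk.inj h
        ext i
        fin_cases i
        · exact congrArg (fun d : (⊤ : SimpleGraph V).Dart => d.snd) h1
        · exact congrArg (fun d : (⊤ : SimpleGraph V).Dart => d.fst) h1
        · exact congrArg (fun d : (⊤ : SimpleGraph V).Dart => d.snd) h2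
      · rintro ⟨d, d'⟩ hp
        obtain ⟨v, -, hv⟩ := Finset.mem_biUnion.1 hp
        obtain ⟨-, hd, hd', hlt, hx⟩ := Finset.mem_filter.1 hv
        simp only at hd hd' hlt hx
        subst hd
        obtain ⟨e, h0, h1, h2⟩ := exists_embedding_three d.fst_ne_snd.symm
          (hd' ▸ d'.fst_ne_snd) hlt.ne
        have e1 : (embDart e zero_ne_one_fin_three).symm = d :=
          SimpleGraph.Dart.ext _ _ (Prod.ext h1 h0)
        have e2 : embDart e one_ne_two_fin_three = d' :=
          SimpleGraph.Dart.ext _ _ (Prod.ext (h1.trans hd'.symm) h2)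
        refine ⟨e, Finset.mem_filter.2 ⟨Finset.mem_univ _, ?_, ?_⟩, Prod.ext e1 e2⟩
        · rw [h0, h2]
          exact hlt
        · rw [e1, e2]
          exact ⟨hd'.symm, hx⟩
    · intro v _ w _ hvw
      rw [Function.onFun, Finset.disjoint_left]
      intro p hp hp'
      exact hvw ((Finset.mem_filter.1 hp).2.1.symm.trans (Finset.mem_filter.1 hp').2.1)
  · intro e
    have h1 : (embDart (precomp Fin.revPerm e) zero_ne_one_fin_three).symm =
      embDart e one_ne_two_fin_three := rfl
    have h2 : embDart (precomp Fin.revPerm e) one_ne_two_fin_three =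
      (embDart e zero_ne_one_fin_three).symm := rfl
    rw [h1, h2]
    exact if_congr (F.sameSide_comm _ _) rfl rfl

/-! ### Sums over all cyclic sequences of distinct vertices -/

section CyclicSums

variable {r : ℕ} [NeZero r] [Fact (1 < r)]

/-- The number of ways to extend `k` prescribed members to a sequence of `r` distinct vertices. -/
noncomputable def extensions (V : Type*) [Fintype V] (r k : ℕ) : ℝ :=
  ((Fintype.card V - k).factorial : ℝ) / ((Fintype.card V - r).factorial : ℝ)

theorem sum_cycDart [Fintype V] [DecidableRel (⊤ : SimpleGraph V).Adj]
    (hrn : r ≤ Fintype.card V) (g : (⊤ : SimpleGraph V).Dart → ℝ) (i : ZMod r) :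
    ∑ f : ZMod r ↪ V, g (cycDart f i) = extensions V r 2 * ∑ d, g d := by
  obtain ⟨h, h0, h1⟩ := exists_embedding_two (ne_add_one i)
  have := sum_comp_embedding (V := V) h (by rwa [ZMod.card])
    fun e => g (embDart e zero_ne_one_fin_two)
  rw [sum_embDart, ZMod.card] at this
  rw [extensions, ← this]
  refine Finset.sum_congr rfl fun f _ => congrArg g ?_
  exact SimpleGraph.Dart.ext _ _ (Prod.ext (congrArg f h0.symm) (congrArg f h1.symm))

theorem sum_cycDart_succ [Fintype V]
    (hr : 3 ≤ r) (hrn : r ≤ Fintype.card V)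
    (g : (⊤ : SimpleGraph V).Dart → (⊤ : SimpleGraph V).Dart → ℝ) (i : ZMod r) :
    ∑ f : ZMod r ↪ V, g (cycDart f i) (cycDart f (i + 1)) = extensions V r 3 *
      ∑ e : Fin 3 ↪ V, g (embDart e zero_ne_one_fin_three) (embDart e one_ne_two_fin_three) := by
  have hne : i ≠ i + 1 + 1 := fun h =>
    two_ne_zero_of_three_le hr (by linear_combination -h)
  obtain ⟨h, h0, h1, h2⟩ := exists_embedding_three (ne_add_one i) (ne_add_one (i + 1)) hne
  have := sum_comp_embedding (V := V) h (by rwa [ZMod.card])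
    fun e => g (embDart e zero_ne_one_fin_three) (embDart e one_ne_two_fin_three)
  rw [ZMod.card] at this
  rw [extensions, ← this]
  refine Finset.sum_congr rfl fun f _ => congrArg₂ g ?_ ?_
  · exact SimpleGraph.Dart.ext _ _ (Prod.ext (congrArg f h0.symm) (congrArg f h1.symm))
  · exact SimpleGraph.Dart.ext _ _ (Prod.ext (congrArg f h1.symm) (congrArg f h2.symm))

/-- The crossings of edges without common vertex cancel in the sum over all cycles. -/
theorem HasGenericFront.sum_mutualWrithe_eq_zero [Fintype V]
    (hF : F.HasGenericFront) {i j : ZMod r}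
    (h0 : i ≠ j) (h1 : i ≠ j + 1) (h2 : i + 1 ≠ j) :
    ∑ f : ZMod r ↪ V,
      (mutualWrithe (F.openEdge (cycDart f i)) (F.openEdge (cycDart f j)) : ℝ) = 0 := by
  have h3 : i + 1 ≠ j + 1 := fun h => h0 (add_right_cancel h)
  -- Exchanging the vertices at `j` and `j + 1` reverses dart `j` and fixes dart `i`, as `i` and `i
  -- + 1` avoid both positions. The sum therefore equals its own negative.
  have key := Equiv.sum_comp (precomp (V := V) (Equiv.swap j (j + 1))) fun f : ZMod r ↪ V =>
      (mutualWrithe (F.openEdge (cycDart f i)) (F.openEdge (cycDart f j)) : ℝ)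
  have e1 : ∀ f : ZMod r ↪ V, cycDart (precomp (Equiv.swap j (j + 1)) f) i = cycDart f i := by
    intro f
    refine SimpleGraph.Dart.ext _ _ (Prod.ext ?_ ?_)
    · exact congrArg f (Equiv.swap_apply_of_ne_of_ne h0 h1)
    · exact congrArg f (Equiv.swap_apply_of_ne_of_ne h2 h3)
  have e2 : ∀ f : ZMod r ↪ V, cycDart (precomp (Equiv.swap j (j + 1)) f) j =
      (cycDart f j).symm := by
    intro f
    refine SimpleGraph.Dart.ext _ _ (Prod.ext ?_ ?_)
    · exact congrArg f (Equiv.swap_apply_left _ _)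
    · exact congrArg f (Equiv.swap_apply_right _ _)
  simp only [e1, e2, hF.mutualWrithe_symm_right, Int.cast_neg, Finset.sum_neg_distrib] at key
  linarith

open Classical in
theorem cast_twiceTB_cycDarts (F : LegendrianEmbedding (⊤ : SimpleGraph V)) (f : ZMod r ↪ V) :
    (F.twiceTB (cycDarts f) : ℝ) =
      ∑ i, ∑ j, (mutualWrithe (F.openEdge (cycDart f i)) (F.openEdge (cycDart f j)) : ℝ)
        - ∑ i, (F.cuspsAlongEdge (cycDart f i) : ℝ)
        - ∑ i, if F.SameSide (cycDart f i).symm (cycDart f (i + 1)) then (1 : ℝ) else 0 := by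
  rw [twiceTB]
  simp only [cycDarts, Finset.sum_map, Function.Embedding.coeFn_mk]
  push_cast
  congr 1
  -- Only dart `i + 1` starts where dart `i` ends.
  refine Finset.sum_congr rfl fun i _ => Finset.sum_eq_single (i + 1) (fun j _ hj => ?_) (by simp)
  exact if_neg fun h => hj (f.injective h.1).symm

open Classical in
theorem HasGenericFront.sum_twiceTB [Fintype V] [LinearOrder V]
    [DecidableRel (⊤ : SimpleGraph V).Adj]
    (hF : F.HasGenericFront) (hr : 3 ≤ r)
    (hrn : r ≤ Fintype.card V) :
    ∑ f : ZMod r ↪ V, (F.twiceTB (cycDarts f) : ℝ) =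
      r * (extensions V r 2 * (4 * F.edgeWrithe) + extensions V r 3 * (4 * F.adjacentEdgeWrithe)
        - extensions V r 2 * (2 * F.edgeCusps) - extensions V r 3 * (2 * F.vertexCusps)) := by
  have hconst : ∀ a : ℝ, ∑ _i : ZMod r, a = r * a := fun a => by
    rw [Finset.sum_const, Finset.card_univ, ZMod.card, nsmul_eq_mul]
  have hw : ∀ i : ZMod r, ∑ f : ZMod r ↪ V,
      (mutualWrithe (F.openEdge (cycDart f i)) (F.openEdge (cycDart f i)) : ℝ) =
      extensions V r 2 * (4 * F.edgeWrithe) := by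
    intro i
    rw [sum_cycDart hrn fun d => (mutualWrithe (F.openEdge d) (F.openEdge d) : ℝ)]
    simp only [mutualWrithe_self, Int.cast_mul, Int.cast_ofNat, ← Finset.mul_sum, hF.sum_writhe]
    ring
  have hae : ∀ i : ZMod r, ∑ f : ZMod r ↪ V,
      (mutualWrithe (F.openEdge (cycDart f i)) (F.openEdge (cycDart f (i + 1))) : ℝ) =
      extensions V r 3 * (2 * F.adjacentEdgeWrithe) := by
    intro i
    rw [sum_cycDart_succ hr hrn fun d d' => (mutualWrithe (F.openEdge d) (F.openEdge d') : ℝ),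
      hF.sum_mutualWrithe_adjacent]
  -- Both factors `4` are `2 · 2`. For `w_e`: each edge gives two darts, and `mutualWrithe` of an
  -- edge with itself is twice its writhe. For `w_ae`: each path has two orientations, and both
  -- neighbours `i + 1` and `i - 1`, distinct as `r ≥ 3`, contribute.
  have hM : ∀ i : ZMod r, ∑ j : ZMod r, ∑ f : ZMod r ↪ V,
      (mutualWrithe (F.openEdge (cycDart f i)) (F.openEdge (cycDart f j)) : ℝ) =
      extensions V r 2 * (4 * F.edgeWrithe) + extensions V r 3 * (4 * F.adjacentEdgeWrithe) := by
    intro i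
    have hne1 : i ≠ i - 1 := fun h => ne_add_one (i - 1) (by linear_combination -h)
    have hne2 : i + 1 ≠ i - 1 := fun h =>
      two_ne_zero_of_three_le hr (by linear_combination h)
    rw [← Finset.sum_subset (Finset.subset_univ {i, i + 1, i - 1}) fun j _ hj => ?_]
    · rw [Finset.sum_insert (by simp [hne1, ne_add_one i]), Finset.sum_pair hne2, hw, hae]
      have := hae (i - 1)
      rw [sub_add_cancel] at this
      simp only [mutualWrithe_comm (F.openEdge (cycDart _ i)), this]
      ring
    · simp only [Finset.mem_insert, Finset.mem_singleton, not_or] at hj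
      exact hF.sum_mutualWrithe_eq_zero (fun h => hj.1 h.symm)
        (fun h => hj.2.2 (by rw [h, add_sub_cancel_right])) fun h => hj.2.1 h.symm
  have hce : ∀ i : ZMod r, ∑ f : ZMod r ↪ V, (F.cuspsAlongEdge (cycDart f i) : ℝ) =
      extensions V r 2 * (2 * F.edgeCusps) := by
    intro i
    rw [sum_cycDart hrn fun d => (F.cuspsAlongEdge d : ℝ), F.sum_cuspsAlongEdge]
  have hcv : ∀ i : ZMod r, ∑ f : ZMod r ↪ V,
      (if F.SameSide (cycDart f i).symm (cycDart f (i + 1)) then (1 : ℝ) else 0) =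
      extensions V r 3 * (2 * F.vertexCusps) := by
    intro i
    rw [sum_cycDart_succ hr hrn fun d d' => if F.SameSide d.symm d' then (1 : ℝ) else 0,
      F.sum_sameSide]
  simp only [F.cast_twiceTB_cycDarts, Finset.sum_sub_distrib]
  rw [Finset.sum_comm, Finset.sum_congr rfl fun i _ => Finset.sum_comm,
    Finset.sum_congr rfl fun i _ => hM i, Finset.sum_comm, Finset.sum_congr rfl fun i _ => hce i,
    Finset.sum_comm, Finset.sum_congr rfl fun i _ => hcv i, hconst, hconst, hconst]
  ring

end CyclicSums

open Classical in
-- Each cycle comes from `2r` sequences, and each of them contributes `2 tb`.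
theorem HasGenericFront.sum_twiceTB_eq_TBr [Fintype V]
    (hF : F.HasGenericFront) {r : ℕ} [NeZero r]
    [Fact (1 < r)] (hr : 3 ≤ r) :
    ∑ f : ZMod r ↪ V, (F.twiceTB (cycDarts f) : ℝ) = 4 * r * F.TBr r := by
  have hmaps : ∀ f ∈ (Finset.univ : Finset (ZMod r ↪ V)),
      cycEdges f ∈ cyclesOfLength (⊤ : SimpleGraph V) r := fun f _ =>
    Finset.mem_filter.2 ⟨Finset.mem_filter.2 ⟨Finset.mem_univ _, isCycleEdgeSet_cycEdges hr f⟩,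
      card_cycEdges hr f⟩
  rw [← Finset.sum_fiberwise_of_maps_to hmaps, TBr, Finset.mul_sum]
  refine Finset.sum_congr rfl fun S hS => ?_
  obtain ⟨hS, hcard⟩ := Finset.mem_filter.1 hS
  obtain ⟨f, rfl⟩ := (Finset.mem_filter.1 hS).2.exists_cycEdges hcard
  have hcard : (Finset.univ.filter fun g : ZMod r ↪ V => cycEdges g = cycEdges f).card = 2 * r := by
    convert card_cycEdges_fiber hr f
  rw [Finset.sum_congr rfl fun g hg =>
    congrArg _ (hF.twiceTB_eq_of_cycEdges_eq hr (Finset.mem_filter.1 hg).2), Finset.sum_const,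
    hcard, hF.tb_cycEdges hr f, nsmul_eq_mul]
  push_cast
  ring

theorem HasGenericFront.TBr_eq [Fintype V] [LinearOrder V]
    [DecidableRel (⊤ : SimpleGraph V).Adj]
    (hF : F.HasGenericFront) {r : ℕ} (hr : 3 ≤ r)
    (hrn : r ≤ Fintype.card V) :
    F.TBr r = ((Fintype.card V - 3).factorial : ℝ) / ((Fintype.card V - r).factorial : ℝ) *
      (((Fintype.card V : ℝ) - 2) * F.edgeWrithe + F.adjacentEdgeWrithe
        - (1 / 2) * (((Fintype.card V : ℝ) - 2) * F.edgeCusps + F.vertexCusps)) := by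
  have : NeZero r := ⟨by omega⟩
  have : Fact (1 < r) := ⟨by omega⟩
  have h := (hF.sum_twiceTB_eq_TBr hr).symm.trans (hF.sum_twiceTB hr hrn)
  -- A single edge has `n - 2` times as many extensions as a path of two edges, whatever `r` is;
  -- this gives the common factor `(n-3)!/(n-r)!`.
  have hfac : ((Fintype.card V - 2).factorial : ℝ) =
      ((Fintype.card V : ℝ) - 2) * (Fintype.card V - 3).factorial := by
    have e1 : Fintype.card V - 2 = (Fintype.card V - 3) + 1 := by omega
    rw [e1, Nat.factorial_succ, Nat.cast_mul, ← e1, Nat.cast_sub (by omega), Nat.cast_ofNat]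
  rw [extensions, extensions, hfac] at h
  have hr0 : (4 * r : ℝ) ≠ 0 := by
    have : (r : ℝ) ≠ 0 := by exact_mod_cast NeZero.ne r
    positivity
  refine mul_left_cancel₀ hr0 (h.trans ?_)
  ring

theorem TB_eq_sum_TBr [Fintype V]
    (F : LegendrianEmbedding (⊤ : SimpleGraph V)) :
    F.TB = ∑ r ∈ Finset.Icc 3 (Fintype.card V), F.TBr r := by
  classical
  have hmaps : ∀ S ∈ cycles (⊤ : SimpleGraph V), S.card ∈ Finset.Icc 3 (Fintype.card V) := by
    intro S hS
    have h := (Finset.mem_filter.1 hS).2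
    exact Finset.mem_Icc.2 ⟨h.three_le_card, h.card_le⟩
  rw [TB, ← Finset.sum_fiberwise_of_maps_to hmaps]
  refine Finset.sum_congr rfl fun r _ => ?_
  rw [TBr, cyclesOfLength]

theorem TBr_eq_zero_of_card_lt [Fintype V]
    (F : LegendrianEmbedding (⊤ : SimpleGraph V)) {r : ℕ}
    (h : Fintype.card V < r) : F.TBr r = 0 := by
  classical
  rw [TBr]
  refine Finset.sum_eq_zero fun S hS => ?_
  obtain ⟨hS, hcard⟩ := Finset.mem_filter.1 hS
  have := (Finset.mem_filter.1 hS).2.card_le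
  omega

theorem adjacentEdgeWrithe_eq_zero_of_card_lt [Fintype V] [LinearOrder V]
    [DecidableRel (⊤ : SimpleGraph V).Adj]
    (F : LegendrianEmbedding (⊤ : SimpleGraph V))
    (h : Fintype.card V < 3) : F.adjacentEdgeWrithe = 0 := by
  refine Finset.sum_eq_zero fun p hp => ?_
  obtain ⟨hdd, hlt⟩ := (Finset.mem_filter.1 hp).2
  obtain ⟨e, -⟩ := exists_embedding_three p.1.fst_ne_snd (hdd ▸ p.2.fst_ne_snd) hlt.ne
  have := Fintype.card_le_of_embedding e
  rw [Fintype.card_fin] at this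
  omega

theorem vertexCusps_eq_zero_of_card_lt [Fintype V] [LinearOrder V]
    [DecidableRel (⊤ : SimpleGraph V).Adj]
    (F : LegendrianEmbedding (⊤ : SimpleGraph V))
    (h : Fintype.card V < 3) : F.vertexCusps = 0 := by
  refine Finset.sum_eq_zero fun v _ => ?_
  rw [cuspsAtVertex, Finset.card_eq_zero, Finset.filter_eq_empty_iff]
  rintro ⟨d, d'⟩ - ⟨hd, hd', hlt, -⟩
  simp only at hd hd' hlt
  subst hd
  obtain ⟨e, -⟩ := exists_embedding_three d.fst_ne_snd.symm (hd' ▸ d'.fst_ne_snd) hlt.ne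
  have := Fintype.card_le_of_embedding e
  rw [Fintype.card_fin] at this
  omega

theorem isEmpty_dart_of_card_lt [Fintype V]
    (h : Fintype.card V < 2) : IsEmpty (⊤ : SimpleGraph V).Dart := by
  refine ⟨fun d => ?_⟩
  obtain ⟨e, -⟩ := exists_embedding_two d.fst_ne_snd
  have := Fintype.card_le_of_embedding e
  rw [Fintype.card_fin] at this
  omega

theorem HasGenericFront.TBr_three [Fintype V] [LinearOrder V]
    [DecidableRel (⊤ : SimpleGraph V).Adj]
    (hF : F.HasGenericFront) :
    F.TBr 3 = ((Fintype.card V : ℝ) - 2) * F.edgeWrithe + F.adjacentEdgeWrithe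
      - (1 / 2) * (((Fintype.card V : ℝ) - 2) * F.edgeCusps + F.vertexCusps) := by
  -- With fewer than three vertices there are no cycles and no adjacent edges. For `n = 2` the
  -- coefficient `n - 2` kills the edge terms; for `n < 2` there are no edges.
  rcases lt_or_ge (Fintype.card V) 3 with h | h
  · rw [F.TBr_eq_zero_of_card_lt h, F.adjacentEdgeWrithe_eq_zero_of_card_lt h,
      F.vertexCusps_eq_zero_of_card_lt h]
    rcases lt_or_ge (Fintype.card V) 2 with h2 | h2
    · have := isEmpty_dart_of_card_lt h2
      simp [edgeWrithe, edgeCusps]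
    · have : Fintype.card V = 2 := by omega
      simp [this]
  · rw [hF.TBr_eq le_rfl h, div_self (by positivity), one_mul]

end LegendrianEmbedding

end LegendrianGraph

theorem mainTheorem1 (n : ℕ)
    (F : LegendrianGraph.LegendrianEmbedding (⊤ : SimpleGraph (Fin n)))
    (hF : F.HasGenericFront) :
    -- the numbers `tb` of the cycles are well defined
    (∀ (v : Fin n) (c : (⊤ : SimpleGraph (Fin n)).Walk v v), c.IsCycle →
      ∀ᶠ ε in 𝓝[>] (0 : ℝ),
        LegendrianGraph.linkingNumber (F.loop c) (LegendrianGraph.pushOff ε (F.loop c)) =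
          F.tb c.edges.toFinset) ∧
    (∀ r : ℕ, 3 ≤ r → r ≤ n →
      F.TBr r = ((n - 3).factorial : ℝ) / ((n - r).factorial : ℝ) * F.TBr 3) ∧
    F.TB = F.TBr 3 *
      ∑ r ∈ Finset.Icc 3 n, ((n - 3).factorial : ℝ) / ((n - r).factorial : ℝ) ∧
    F.TBr 3 = ((n : ℝ) - 2) * F.edgeWrithe + F.adjacentEdgeWrithe
      - (1 / 2) * (((n : ℝ) - 2) * F.edgeCusps + F.vertexCusps) := by
  have h3 := hF.TBr_three
  have hr : ∀ r : ℕ, 3 ≤ r → r ≤ n →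
      F.TBr r = ((n - 3).factorial : ℝ) / ((n - r).factorial : ℝ) * F.TBr 3 := by
    intro r hr hrn
    rw [h3]
    simpa only [Fintype.card_fin] using hF.TBr_eq hr (by rwa [Fintype.card_fin])
  rw [Fintype.card_fin] at h3
  refine ⟨fun v c hc => ?_, hr, ?_, h3⟩
  · have hlen := hc.three_le_length
    have : NeZero c.length := ⟨by omega⟩
    have : Fact (1 < c.length) := ⟨by omega⟩
    obtain ⟨f, -, hf⟩ := LegendrianGraph.exists_cyclicSequence hc rfl
    have hedges := LegendrianGraph.mem_edges_iff_of_darts hf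
    have hS : c.edges.toFinset = LegendrianGraph.cycEdges f := by
      ext e
      rw [List.mem_toFinset, hedges]
    rw [hS, hF.tb_cycEdges hlen f]
    exact hF.eventually_linkingNumber_cycle hlen hc f hedges
  · rw [F.TB_eq_sum_TBr, Fintype.card_fin, Finset.mul_sum]
    refine Finset.sum_congr rfl fun r hmem => ?_
    obtain ⟨h1, h2⟩ := Finset.mem_Icc.1 hmem
    rw [hr r h1 h2, mul_comm]
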